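/- **Setting.** Let $(S,P,R,\gamma)$ be a finite Markov reward process ($P$ a stochastic matrix on $S$, $R\in\mathbb R^S$, $0\le\gamma<1$) with value function $V=\sum_{i\ge0}\gamma^iP^iR$. Let $\xi$ be a probability distribution on $S$ with $\xi(s)>0$ for all $s$, $\Xi=\mathrm{diag}(\xi)$, and let $\Phi\in\mathbb R^{S\times d}$ have full column rank, with rows $\phi(s)^{T}$; put $V_\theta=\Phi\theta$. Write $$M=\Phi^T\Xi\Phi,\quad A=\Phi^T\Xi(\Phi-\gamma P\Phi),\quad K(\theta)=\Phi^T\Xi(R+\gamma P\Phi\theta-\Phi\theta),\quad \Pi^\Xi=\Phi M^{-1}\Phi^T\Xi,$$ $$L_\phi^\Xi=\max_s\|M^{-1}\phi(s)\|_1,\qquad L_K=\|A\|_2^2,$$ with $L_{F^*}=1$ for GTD and $L_{F^*}=\|M\|_2$ for GTD2 and GTD2-MP. Assume a rich hypothesis space: $\Pi^\Xi P=P$ and $\Pi^\Xi R=R$; then $V=\Phi\theta^*$ for some $\theta^*$. The samples $(s_t,r_t,s_t')$, $t\ge1$, are i.i.d. with $s_t\sim\xi$, $s'_t\sim P(s_t,\cdot)$,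 $\mathbb E[r_t\mid s_t]=R(s_t)$ and $\mathbb E[r_t^2]<\infty$. Put $\phi_t=\phi(s_t)$, $\phi'_t=\phi(s'_t)$, $\delta_t(\theta)=r_t+\gamma\phi_t'^T\theta-\phi_t^T\theta$. Let $X\subseteq\mathbb R^d$ be closed and convex with $\theta^*\in X$, let $\Pi_X$ be the Euclidean projection on $X$ (the proximal map of the regularizer $h=0$), and let $Y\subseteq\mathbb R^d$ contain $0$. From $\theta_1\in X$ and $w_1\in Y$ the algorithms compute: * GTD: $w_{t+1}=w_t+\alpha_t(\delta_t(\theta_t)\phi_t-w_t)$, $\ \theta_{t+1}=\Pi_X(\theta_t+\alpha_t(\phi_t-\gamma\phi'_t)\phi_t^Tw_t)$. * GTD2: $w_{t+1}=w_t+\alpha_t(\delta_t(\theta_t)-\phi_t^Tw_t)\phi_t$, $\ \theta_{t+1}=\Pi_X(\theta_t+\alpha_t(\phi_t-\gamma\phi'_t)\phi_t^Tw_t)$. * GTD2-MP: $w_{t+1/2}=w_t+\beta_t(\delta_t(\theta_t)-\phi_t^Tw_t)\phi_t$, $\ \theta_{t+1/2}=\Pi_X(\theta_t+\alpha_t(\phi_t-\gamma\phi_t')\phi_t^Tw_t)$,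 $\ w_{t+1}=w_t+\beta_t(\delta_t(\theta_{t+1/2})-\phi_t^Tw_{t+1/2})\phi_t$, $\ \theta_{t+1}=\Pi_X(\theta_t+\alpha_t(\phi_t-\gamma\phi'_t)\phi_t^Tw_{t+1/2})$. The output is the average $\bar\theta_N=\frac1N\sum_{i=1}^N\theta_i$. Let $\sigma=\sqrt{\sigma_{F^*}^2+\sigma_{K,\theta}^2}+\sigma_{K,y}$, where $\sigma_{F^*},\sigma_{K,\theta},\sigma_{K,y}\ge0$ satisfy, for all $\theta\in X$ and $y\in Y$: $\mathbb E\|\delta_t(\theta)\phi_t-K(\theta)\|^2\le\sigma_{K,\theta}^2$; $\ \mathbb E\|(\phi_t-\gamma\phi'_t)\phi_t^Ty-A^Ty\|^2\le\sigma_{K,y}^2$; and, for GTD2 and GTD2-MP, $\mathbb E\|\phi_t\phi_t^Ty-My\|^2\le\sigma_{F^*}^2$ (for GTD the gradient of $F^*(y)=\frac12\|y\|^2$ is exact, so that any $\sigma_{F^*}\ge 0$ is allowed). **Proposition 3 (value approximation error bound).** Let $B,\kappa,D$ be real numbers. For each of the three algorithms there are positive step sizes ($\alpha_t$, and $\beta_t$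 for GTD2-MP) and a constant $C$, all depending only on $B,\kappa,D$, such that in every setting as above with $\|\phi(s)\|_2\le B$ for all $s$, $\|M^{-1}\|_2\le\kappa$, $\|A^{-1}\|_2\le\kappa$, $\|\theta_1-\theta^*\|_2\le D$ and $\|w_1\|_2\le D$, and for every $N\ge1$, the error $\|V-V_{\bar\theta_N}\|_\infty$ is integrable and $$\mathbb E\,\|V-V_{\bar\theta_N}\|_\infty\le\frac{L_\phi^\Xi}{1-\gamma}\cdot C\,\frac{L_{F^*}+L_K+\sigma}{\sqrt N}\quad\text{for GTD and GTD2},$$ $$\mathbb E\,\|V-V_{\bar\theta_N}\|_\infty\le\frac{L_\phi^\Xi}{1-\gamma}\cdot C\left(\frac{L_{F^*}+L_K}{N}+\frac{\sigma}{\sqrt N}\right)\quad\text{for GTD2-MP}.$$ -/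

import Mathlib

open MeasureTheory ProbabilityTheory
open scoped Matrix InnerProductSpace

noncomputable section

namespace GradientTD

/-- The parameter space `ℝ^d` with its Euclidean norm (both `θ` and the dual variable live here). -/
abbrev Vec (d : ℕ) := EuclideanSpace ℝ (Fin d)

/-- A finite Markov reward process `(S, P, R, γ)`, a positive sampling distribution `ξ` on the
states, and a feature matrix `Φ` whose `s`-th row is the feature vector of `s`. -/
structure Model (S : Type*) [Fintype S] (d : ℕ) where
  P : Matrix S S ℝ
  R : S → ℝ
  γ : ℝ
  ξ : S → ℝ
  Φ : Matrix S (Fin d) ℝ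
  P_nonneg : ∀ s s', 0 ≤ P s s'
  P_sum : ∀ s, ∑ s', P s s' = 1
  γ_nonneg : 0 ≤ γ
  γ_lt_one : γ < 1
  ξ_pos : ∀ s, 0 < ξ s
  ξ_sum : ∑ s, ξ s = 1

/-- One training sample `(s, r, s')`. -/
abbrev Sample (S : Type*) := S × ℝ × S

/-- The proximal map `prox_h(x) = argmin_{u ∈ X} (h(u) + ½‖u - x‖²)`. -/
def prox {d : ℕ} (X : Set (Vec d)) (h : Vec d → ℝ) (x : Vec d) : Vec d :=
  Classical.epsilon fun u => u ∈ X ∧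
    ∀ v ∈ X, h u + (1 / 2) * ‖u - x‖ ^ 2 ≤ h v + (1 / 2) * ‖v - x‖ ^ 2

/-- The spectral norm (the operator norm for the Euclidean norm) of a square matrix. -/
def specNorm {d : ℕ} (A : Matrix (Fin d) (Fin d) ℝ) : ℝ :=
  ‖Matrix.toEuclideanCLM (n := Fin d) (𝕜 := ℝ) A‖

/-- Averages `(1/N) ∑_{i=1}^N θ_i` of the first `N` terms; the first iterate has index `0`. -/
def average {d : ℕ} (θ : ℕ → Vec d) (N : ℕ) : Vec d :=
  (1 / (N : ℝ)) • ∑ i ∈ Finset.range N, θ i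

/-- `σ = √(σ_{F*}² + σ_{K,θ}²) + σ_{K,y}`. -/
def totalNoise (σF σK σy : ℝ) : ℝ := Real.sqrt (σF ^ 2 + σK ^ 2) + σy

namespace Model

variable {S : Type*} [Fintype S] [DecidableEq S] {d : ℕ} (m : Model S d)

/-- The value function: the expected discounted sum of rewards, `V = ∑ᵢ γⁱ Pⁱ R`. -/
def V (s : S) : ℝ := ∑' i : ℕ, m.γ ^ i * ((m.P ^ i) *ᵥ m.R) s

/-- The approximate value function `V_θ = Φ θ`. -/
def approxV (θ : Vec d) : S → ℝ := m.Φ *ᵥ θ.ofLp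

/-- The feature vector `φ(s)`. -/
def φ (s : S) : Vec d := WithLp.toLp 2 (m.Φ s)

/-- `Ξ`, the diagonal matrix of the distribution `ξ`. -/
def Ξ : Matrix S S ℝ := Matrix.diagonal m.ξ

/-- `M = Φᵀ Ξ Φ = 𝔼[φ φᵀ]`. -/
def M : Matrix (Fin d) (Fin d) ℝ := m.Φᵀ * m.Ξ * m.Φ

/-- `A = Φᵀ Ξ (Φ - γ Φ') = 𝔼[φ (φ - γ φ')ᵀ]`, where `Φ' = P Φ`. -/
def A : Matrix (Fin d) (Fin d) ℝ := m.Φᵀ * m.Ξ * (m.Φ - m.γ • (m.P * m.Φ))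

/-- `K(θ) = Φᵀ Ξ (R + γ Φ' θ - Φ θ)`. -/
def K (θ : Vec d) : Vec d :=
  WithLp.toLp 2 ((m.Φᵀ * m.Ξ) *ᵥ
    (m.R + m.γ • ((m.P * m.Φ) *ᵥ θ.ofLp) - m.Φ *ᵥ θ.ofLp))

/-- `∇K(θ)ᵀ y = - Aᵀ y`. -/
def gradKT (y : Vec d) : Vec d := - WithLp.toLp 2 (m.Aᵀ *ᵥ y.ofLp)

/-- `Π^Ξ = Φ (Φᵀ Ξ Φ)⁻¹ Φᵀ Ξ`, the `ξ`-weighted orthogonal projection on the column span. -/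
def proj : Matrix S S ℝ := m.Φ * m.M⁻¹ * m.Φᵀ * m.Ξ

/-- The rich hypothesis space condition: `Π^Ξ P = P` and `Π^Ξ R = R`. -/
def Rich : Prop := m.proj * m.P = m.P ∧ m.proj *ᵥ m.R = m.R

/-- `L_φ^Ξ = max_s ‖(Φᵀ Ξ Φ)⁻¹ φ(s)‖₁`. -/
def Lφ : ℝ := ⨆ s, ∑ j, |(m.M⁻¹ *ᵥ m.Φ s) j|

/-- `L_K = ‖Φᵀ Ξ (Φ - γ Φ')‖²`. -/
def LK : ℝ := specNorm m.A ^ 2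

/-- `L_{F*}` for GTD, where `F*(y) = ½ ‖y‖²`. -/
def LFgtd (_m : Model S d) : ℝ := 1

/-- `L_{F*}` for GTD2 and GTD2-MP, where `F*(w) = ½ wᵀ M w`. -/
def LFgtd2 : ℝ := specNorm m.M

/-- The temporal difference error `δ(θ) = r + γ φ'ᵀ θ - φᵀ θ` on a sample. -/
def tdError (z : Sample S) (θ : Vec d) : ℝ :=
  z.2.1 + m.γ * ⟪m.φ z.2.2, θ⟫_ℝ - ⟪m.φ z.1, θ⟫_ℝ

/-- The stochastic oracle `δ(θ) φ` for `K(θ)`. -/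
def oracleK (z : Sample S) (θ : Vec d) : Vec d := m.tdError z θ • m.φ z.1

/-- The stochastic oracle `- (φ - γ φ') (φᵀ y)` for `∇K(θ)ᵀ y`. -/
def oracleKy (z : Sample S) (y : Vec d) : Vec d :=
  - (⟪m.φ z.1, y⟫_ℝ • (m.φ z.1 - m.γ • m.φ z.2.2))

/-- The gradient `∇F*(y) = y` for GTD. -/
def gradFgtd (_m : Model S d) (y : Vec d) : Vec d := y

/-- The (exact) oracle for `∇F*(y) = y` for GTD. -/
def oracleFgtd (_m : Model S d) (_z : Sample S) (y : Vec d) : Vec d := y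

/-- The gradient `∇F*(w) = M w` for GTD2 and GTD2-MP. -/
def gradFgtd2 (w : Vec d) : Vec d := WithLp.toLp 2 (m.M *ᵥ w.ofLp)

/-- The stochastic oracle `φ (φᵀ w)` for `∇F*(w) = M w`. -/
def oracleFgtd2 (z : Sample S) (w : Vec d) : Vec d := ⟪m.φ z.1, w⟫_ℝ • m.φ z.1

/-- GTD, with constraint set `X`, regularizer `h` and step sizes `α`:
`y ← y + α (δ φ - y)`, `θ ← prox_{αh} (θ + α (φ - γ φ') (yᵀ φ))`.
The state is the pair `(θ, y)`. -/
def gtd (X : Set (Vec d)) (h : Vec d → ℝ) (α : ℕ → ℝ) (θ₁ y₁ : Vec d) (z : ℕ → Sample S) :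
    ℕ → Vec d × Vec d
  | 0 => (θ₁, y₁)
  | t + 1 =>
    let θ := (gtd X h α θ₁ y₁ z t).1
    let y := (gtd X h α θ₁ y₁ z t).2
    let φ := m.φ (z t).1
    let φ' := m.φ (z t).2.2
    (prox X (α t • h) (θ + α t • (⟪y, φ⟫_ℝ • (φ - m.γ • φ'))),
      y + α t • (m.tdError (z t) θ • φ - y))

/-- GTD2, with constraint set `X`, regularizer `h` and step sizes `α`:
`w ← w + α (δ - φᵀ w) φ`, `θ ← prox_{αh} (θ + α (φ - γ φ') (wᵀ φ))`.
The state is the pair `(θ, w)`. -/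
def gtd2 (X : Set (Vec d)) (h : Vec d → ℝ) (α : ℕ → ℝ) (θ₁ w₁ : Vec d) (z : ℕ → Sample S) :
    ℕ → Vec d × Vec d
  | 0 => (θ₁, w₁)
  | t + 1 =>
    let θ := (gtd2 X h α θ₁ w₁ z t).1
    let w := (gtd2 X h α θ₁ w₁ z t).2
    let φ := m.φ (z t).1
    let φ' := m.φ (z t).2.2
    (prox X (α t • h) (θ + α t • (⟪w, φ⟫_ℝ • (φ - m.γ • φ'))),
      w + α t • ((m.tdError (z t) θ - ⟪φ, w⟫_ℝ) • φ))

/-- GTD2-MP, the extragradient version of GTD2, with step sizes `α` (for `θ`) and `β` (for `w`).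
Both half steps use the same sample. The state is the pair `(θ, w)`. -/
def gtd2mp (X : Set (Vec d)) (h : Vec d → ℝ) (α β : ℕ → ℝ) (θ₁ w₁ : Vec d)
    (z : ℕ → Sample S) : ℕ → Vec d × Vec d
  | 0 => (θ₁, w₁)
  | t + 1 =>
    let θ := (gtd2mp X h α β θ₁ w₁ z t).1
    let w := (gtd2mp X h α β θ₁ w₁ z t).2
    let φ := m.φ (z t).1
    let φ' := m.φ (z t).2.2
    let wHalf := w + β t • ((m.tdError (z t) θ - ⟪φ, w⟫_ℝ) • φ)
    let θHalf := prox X (α t • h) (θ + α t • (⟪φ, w⟫_ℝ • (φ - m.γ • φ')))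
    (prox X (α t • h) (θ + α t • (⟪φ, wHalf⟫_ℝ • (φ - m.γ • φ'))),
      w + β t • ((m.tdError (z t) θHalf - ⟪φ, wHalf⟫_ℝ) • φ))

/-- `Z` is an i.i.d. sequence of samples `(s, r, s')` with `s ∼ ξ`, `s' ∼ P(s, ·)` and
`𝔼[r | s] = R(s)`, the reward having a finite second moment. -/
structure IsIIDSample [MeasurableSpace S] {Ω : Type*} [MeasurableSpace Ω] (μ : Measure Ω)
    (Z : ℕ → Ω → Sample S) : Prop where
  measurable : ∀ t, Measurable (Z t)
  indep : iIndepFun Z μ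
  ident : ∀ t, IdentDistrib (Z t) (Z 0) μ μ
  transition : ∀ s s', μ.real {ω | (Z 0 ω).1 = s ∧ (Z 0 ω).2.2 = s'} = m.ξ s * m.P s s'
  reward_memLp : MemLp (fun ω => (Z 0 ω).2.1) 2 μ
  reward_mean : ∀ s, ∫ ω in {ω | (Z 0 ω).1 = s}, (Z 0 ω).2.1 ∂μ = m.ξ s * m.R s

/-- The variances of the three stochastic oracles (for a sample distributed as `Z₀`) are bounded on
`X × Y` by `σ_{F*}²`, `σ_{K,θ}²` and `σ_{K,y}²`. -/
structure NoiseBound {Ω : Type*} [MeasurableSpace Ω] (μ : Measure Ω) (Z₀ : Ω → Sample S)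
    (oracleF : Sample S → Vec d → Vec d) (gradF : Vec d → Vec d) (X Y : Set (Vec d))
    (σF σK σy : ℝ) : Prop where
  σF_nonneg : 0 ≤ σF
  σK_nonneg : 0 ≤ σK
  σy_nonneg : 0 ≤ σy
  boundF : ∀ y ∈ Y, ∫ ω, ‖oracleF (Z₀ ω) y - gradF y‖ ^ 2 ∂μ ≤ σF ^ 2
  boundK : ∀ θ ∈ X, ∫ ω, ‖m.oracleK (Z₀ ω) θ - m.K θ‖ ^ 2 ∂μ ≤ σK ^ 2
  boundKy : ∀ y ∈ Y, ∫ ω, ‖m.oracleKy (Z₀ ω) y - m.gradKT y‖ ^ 2 ∂μ ≤ σy ^ 2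

/-- The standing assumptions: full column rank of `Φ`; a bound `B` on the features and a bound `κ`
on the inverses of `𝔼[φ φᵀ]` and `𝔼[φ (φ - γ φ')ᵀ]`; a rich hypothesis space; a closed convex
constraint set `X` that contains the starting point and the parameter `θs` that represents `V`;
a dual set `Y` that contains the starting point and the optimal dual value `0`; and a bound `D` on
the distance from the starting point to the saddle point `(θs, 0)`. -/
structure Standing (B κ D : ℝ) (X Y : Set (Vec d)) (θ₁ y₁ : Vec d) : Prop where
  rank : m.Φ.rank = d
  feature_le : ∀ s, ‖m.φ s‖ ≤ B
  invM_le : specNorm m.M⁻¹ ≤ κ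
  invA_le : specNorm m.A⁻¹ ≤ κ
  rich : m.Rich
  X_closed : IsClosed X
  X_convex : Convex ℝ X
  θ₁_mem : θ₁ ∈ X
  y₁_mem : y₁ ∈ Y
  zero_mem : (0 : Vec d) ∈ Y
  saddle : ∃ θs ∈ X, m.approxV θs = m.V ∧ ‖θ₁ - θs‖ ≤ D
  y₁_le : ‖y₁‖ ≤ D

end Model

end GradientTD

end

/-! All three algorithms are stochastic approximations of one linear saddle dynamics. With `θs`
representing `V` and `e = θ - θs`, the Bellman equation gives `K(θ) = -A e`, so the mean directions
are `Aᵀ w` for `θ` and `-(A e + H w)` for the dual variable, where `H = 1` for GTD and `H = M` for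
GTD2 and GTD2-MP. The rest point is `(θs, 0)`.

In the squared distance `‖e‖² + ‖w‖²` the bilinear terms cancel and only `w` is damped, by `-2⟪w, H
w⟫`. Adding a small multiple `c⟪w, A e⟫` produces the missing `-c‖A e‖²`, which controls `‖e‖²`
because `A` is invertible with `‖A⁻¹‖ ≤ κ`. The resulting Lyapunov function contracts in mean at a
rate fixed by `B` and `κ` (`lyapunov_step_le`, `drift_le`). The projection is harmless: it does not
increase the distance to `θs`, and its effect on the cross term is bounded by a multiple of `‖w‖²`,
which the damping absorbs.

The noise has a part linear in `(e, w)`, bounded through the features and absorbed for small steps,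
and an additive part, the oracle of `K` at `θs`. As `K(θs) = 0`, the second moment of the latter is
at most `σ_{K,θ}²`. With steps of order `1/t` and contraction factor `1 - 4/s`, `s = t + offset`,
the mean Lyapunov value is `O(s⁻⁴) + O(σ²/s)`; its square root is `O(s⁻²) + O(σ/√s)`, and averaging
gives `O(1/N + σ/√N)`. The first part is summable, so even the bound for GTD2-MP follows without
using the extragradient structure: its step is the GTD2 step up to an error of second order in the
step size (`isPerturbedStep_extraStep`).

Finally `‖Φ x‖_∞ ≤ L_φ ‖M x‖` turns parameter error into value error. The remaining factors only
enlarge the bound: `1 / (1 - γ) ≥ 1`, `L_K ≥ 0`, and either `L_{F*} = 1` or `1 ≤ κ‖M‖`. -/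

namespace GradientTD

/-! ### Euclidean projection onto a closed convex set -/

section Projection

variable {d : ℕ} {X : Set (Vec d)}

/-- For `h = 0` the minimizers of the proximal objective are the nearest points of `X`. Existence
makes the choice operator meaningful, and the inequality is the variational characterization of a
nearest point. -/
theorem prox_zero_spec (hc : IsClosed X) (hX : Convex ℝ X) (hne : X.Nonempty) (a : ℝ) (x : Vec d) :
    prox X (a • (0 : Vec d → ℝ)) x ∈ X ∧
      ∀ v ∈ X, ⟪x - prox X (a • (0 : Vec d → ℝ)) x, v - prox X (a • (0 : Vec d → ℝ)) x⟫_ℝ ≤ 0 := by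
  have hex : ∃ u, u ∈ X ∧ ∀ v ∈ X, (a • (0 : Vec d → ℝ)) u + (1 / 2) * ‖u - x‖ ^ 2 ≤
      (a • (0 : Vec d → ℝ)) v + (1 / 2) * ‖v - x‖ ^ 2 := by
    obtain ⟨u, hu, h⟩ := hc.exists_infDist_eq_dist hne x
    refine ⟨u, hu, fun v hv => ?_⟩
    have := Metric.infDist_le_dist_of_mem (x := x) hv
    rw [h, dist_comm, dist_comm x v, dist_eq_norm, dist_eq_norm] at this
    simp only [smul_zero, Pi.zero_apply, zero_add]
    gcongr
  have hp := Classical.epsilon_spec hex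
  change prox X (a • (0 : Vec d → ℝ)) x ∈ X ∧ _ at hp
  obtain ⟨hmem, hmin⟩ := hp
  set p := prox X (a • (0 : Vec d → ℝ)) x
  refine ⟨hmem, ?_⟩
  have hinf : ‖x - p‖ = ⨅ w : X, ‖x - w‖ := by
    have : Nonempty X := hne.to_subtype
    refine le_antisymm (le_ciInf fun w => ?_) ?_
    · have := hmin w w.2
      change (a • (0 : Vec d → ℝ)) p + (1 / 2) * ‖p - x‖ ^ 2 ≤ _ at this
      simp only [Pi.smul_apply, Pi.zero_apply, smul_zero, zero_add] at this
      rw [norm_sub_rev x p, norm_sub_rev x]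
      exact le_of_sq_le_sq (by linarith) (norm_nonneg _)
    · exact ciInf_le ⟨0, by rintro _ ⟨w, rfl⟩; positivity⟩ (⟨p, hmem⟩ : X)
  exact (norm_eq_iInf_iff_real_inner_le_zero hX hmem).1 hinf

theorem prox_zero_mem (hc : IsClosed X) (hX : Convex ℝ X) (hne : X.Nonempty) (a : ℝ) (x : Vec d) :
    prox X (a • (0 : Vec d → ℝ)) x ∈ X :=
  (prox_zero_spec hc hX hne a x).1

theorem norm_prox_zero_sub_le (hc : IsClosed X) (hX : Convex ℝ X) (hne : X.Nonempty) (a : ℝ)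
    (x y : Vec d) :
    ‖prox X (a • (0 : Vec d → ℝ)) x - prox X (a • (0 : Vec d → ℝ)) y‖ ≤ ‖x - y‖ := by
  obtain ⟨hp, hp'⟩ := prox_zero_spec hc hX hne a x
  obtain ⟨hq, hq'⟩ := prox_zero_spec hc hX hne a y
  set p := prox X (a • (0 : Vec d → ℝ)) x
  set q := prox X (a • (0 : Vec d → ℝ)) y
  have h1 := hp' q hq
  have h2 := hq' p hp
  -- Adding the two variational inequalities gives firm nonexpansiveness; Cauchy–Schwarz then gives
  -- the Lipschitz bound.
  have h3 : ‖p - q‖ ^ 2 ≤ ⟪x - y, p - q⟫_ℝ := by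
    rw [← real_inner_self_eq_norm_sq]
    simp only [inner_sub_left, inner_sub_right] at h1 h2 ⊢
    linarith
  have h4 := real_inner_le_norm (x - y) (p - q)
  rcases (norm_nonneg (p - q)).eq_or_lt with h | h
  · rw [← h]; positivity
  · nlinarith

theorem prox_zero_of_mem (hc : IsClosed X) (hX : Convex ℝ X) (a : ℝ) {x : Vec d} (hx : x ∈ X) :
    prox X (a • (0 : Vec d → ℝ)) x = x := by
  have h := (prox_zero_spec hc hX ⟨x, hx⟩ a x).2 x hx
  rw [real_inner_self_nonpos, sub_eq_zero] at h
  exact h.symm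

theorem norm_prox_zero_sub_le_of_mem (hc : IsClosed X) (hX : Convex ℝ X) (a : ℝ) {y : Vec d}
    (hy : y ∈ X) (x : Vec d) : ‖prox X (a • (0 : Vec d → ℝ)) x - y‖ ≤ ‖x - y‖ := by
  simpa only [prox_zero_of_mem hc hX a hy] using norm_prox_zero_sub_le hc hX ⟨y, hy⟩ a x y

theorem measurable_prox_zero (hc : IsClosed X) (hX : Convex ℝ X) (hne : X.Nonempty) (a : ℝ) :
    Measurable (prox X (a • (0 : Vec d → ℝ))) := by
  refine Continuous.measurable (LipschitzWith.continuous (K := 1) ?_)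
  refine LipschitzWith.of_dist_le_mul fun x y => ?_
  simpa [dist_eq_norm] using norm_prox_zero_sub_le hc hX hne a x y

end Projection

end GradientTD

namespace GradientTD

/-! ### Lyapunov function: one-step change and mean drift -/

section Lyapunov

variable {E : Type*} [NormedAddCommGroup E] [InnerProductSpace ℝ E]

/-- The Lyapunov function: the squared distance to the saddle point plus a small cross term, which
makes the bilinear coupling dissipate in the primal error as well. -/
def lyapunov (c : ℝ) (T : E →L[ℝ] E) (e w : E) : ℝ := ‖e‖ ^ 2 + ‖w‖ ^ 2 + c * ⟪w, T e⟫_ℝ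

theorem abs_inner_map_le {T : E →L[ℝ] E} {G : ℝ} (hT : ∀ x, ‖T x‖ ≤ G * ‖x‖) (w e : E) :
    |⟪w, T e⟫_ℝ| ≤ G * (‖w‖ * ‖e‖) :=
  (abs_real_inner_le_norm w (T e)).trans <| by
    nlinarith [mul_le_mul_of_nonneg_left (hT e) (norm_nonneg w)]

/-- With `c G ≤ 1/2` the cross term is at most half of `‖w‖ ‖e‖`, so the Lyapunov function is
equivalent to the squared distance. -/
theorem le_lyapunov {c G : ℝ} {T : E →L[ℝ] E} (hT : ∀ x, ‖T x‖ ≤ G * ‖x‖) (hc : 0 ≤ c)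
    (hcG : c * G ≤ 1 / 2) (e w : E) : (‖e‖ ^ 2 + ‖w‖ ^ 2) / 2 ≤ lyapunov c T e w := by
  have h1 := abs_le.1 (abs_inner_map_le hT w e)
  have h2 : c * (G * (‖w‖ * ‖e‖)) ≤ 1 / 2 * (‖w‖ * ‖e‖) := by
    rw [← mul_assoc]; gcongr
  have h3 := mul_le_mul_of_nonneg_left h1.1 hc
  unfold lyapunov
  nlinarith [sq_nonneg (‖w‖ - ‖e‖)]

theorem lyapunov_le {c G : ℝ} {T : E →L[ℝ] E} (hT : ∀ x, ‖T x‖ ≤ G * ‖x‖) (hc : 0 ≤ c)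
    (hcG : c * G ≤ 1 / 2) (e w : E) : lyapunov c T e w ≤ 2 * (‖e‖ ^ 2 + ‖w‖ ^ 2) := by
  have h1 := abs_le.1 (abs_inner_map_le hT w e)
  have h2 : c * (G * (‖w‖ * ‖e‖)) ≤ 1 / 2 * (‖w‖ * ‖e‖) := by
    rw [← mul_assoc]; gcongr
  have h3 := mul_le_mul_of_nonneg_left h1.2 hc
  unfold lyapunov
  nlinarith [sq_nonneg (‖w‖ - ‖e‖)]

/-- Pointwise change of the Lyapunov function along a perturbed projected step. -/
theorem lyapunov_step_le {c G a n : ℝ} {T : E →L[ℝ] E} (hT : ∀ x, ‖T x‖ ≤ G * ‖x‖) (hc : 0 ≤ c)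
    (hc1 : c ≤ 1) (hG : 1 ≤ G) (ha : 0 < a) (ha1 : a ≤ 1) (hn : 0 ≤ n) {e w g h u e' w' : E}
    (hg : ‖g‖ ≤ G * ‖w‖) (hh : ‖h‖ ≤ G * (n + ‖e‖ + ‖w‖))
    (hu : ‖u - g‖ ≤ a * (G * (n + ‖e‖ + ‖w‖)))
    (he : ‖e'‖ ≤ ‖e + a • u‖) (hee : ‖e' - e‖ ≤ a * ‖u‖)
    (hw : ‖w' - (w + a • h)‖ ≤ a ^ 2 * (G * (n + ‖e‖ + ‖w‖))) :
    lyapunov c T e' w' ≤ lyapunov c T e w +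
      a * (2 * ⟪e, g⟫_ℝ + 2 * ⟪w, h⟫_ℝ + c * ⟪h, T e⟫_ℝ + c * G ^ 2 * ‖w‖ ^ 2) +
      54 * G ^ 3 * a ^ 2 * (n ^ 2 + (‖e‖ ^ 2 + ‖w‖ ^ 2)) := by
  set q := n + ‖e‖ + ‖w‖ with hq
  have hne := norm_nonneg e
  have hnw := norm_nonneg w
  have hq0 : 0 ≤ q := by positivity
  have heq : ‖e‖ ≤ q := by linarith
  have hwq : ‖w‖ ≤ q := by linarith
  have hGq : 0 ≤ G * q := by positivity
  have haG : a * (G * q) ≤ G * q := mul_le_of_le_one_left hGq ha1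
  have hG23 : G ^ 2 ≤ G ^ 3 := pow_le_pow_right₀ hG (by norm_num)
  have hG12 : G ≤ G ^ 2 := by nlinarith
  have hu1 : ‖u‖ ≤ G * ‖w‖ + a * (G * q) := by
    have := norm_add_le g (u - g)
    rw [add_sub_cancel] at this; linarith
  have hGw : G * ‖w‖ ≤ G * q := by gcongr
  have hu2 : ‖u‖ ≤ 2 * (G * q) := by linarith
  obtain ⟨v, hv⟩ : ∃ v, v = a⁻¹ • (w' - w) := ⟨_, rfl⟩
  have hw' : w' = w + a • v := by rw [hv, smul_inv_smul₀ ha.ne']; abel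
  have hvh : ‖v - h‖ ≤ a * (G * q) := by
    rw [hw', add_sub_add_left_eq_sub, ← smul_sub, norm_smul, Real.norm_of_nonneg ha.le, sq,
      mul_assoc] at hw
    exact le_of_mul_le_mul_left hw ha
  have hv2 : ‖v‖ ≤ 2 * (G * q) := by
    have := norm_add_le h (v - h)
    rw [add_sub_cancel] at this; linarith
  have husq : ‖u‖ ^ 2 ≤ 4 * (G ^ 2 * q ^ 2) :=
    (pow_le_pow_left₀ (norm_nonneg u) hu2 2).trans_eq (by ring)
  have hvsq : ‖v‖ ^ 2 ≤ 4 * (G ^ 2 * q ^ 2) :=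
    (pow_le_pow_left₀ (norm_nonneg v) hv2 2).trans_eq (by ring)
  have cross : ∀ {x y z : E}, ‖x‖ ≤ q → ‖y - z‖ ≤ a * (G * q) →
      ⟪x, y⟫_ℝ ≤ ⟪x, z⟫_ℝ + a * (G ^ 2 * q ^ 2) := by
    intro x y z hx hyz
    have h1 := real_inner_le_norm x (y - z)
    rw [inner_sub_right] at h1
    have h2 : ‖x‖ * ‖y - z‖ ≤ q * (a * (G * q)) := by gcongr
    have h3 : q * (a * (G * q)) ≤ a * (G ^ 2 * q ^ 2) := by
      have : a * (G * q ^ 2) ≤ a * (G ^ 2 * q ^ 2) := by gcongr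
      linarith
    linarith
  have h1 : ‖e'‖ ^ 2 ≤ ‖e‖ ^ 2 + 2 * a * ⟪e, g⟫_ℝ + 6 * a ^ 2 * (G ^ 2 * q ^ 2) := by
    have h2 : ‖e'‖ ^ 2 ≤ ‖e + a • u‖ ^ 2 := by gcongr
    rw [norm_add_sq_real, inner_smul_right, norm_smul, Real.norm_of_nonneg ha.le, mul_pow] at h2
    linarith [mul_le_mul_of_nonneg_left (cross heq hu) ha.le,
      mul_le_mul_of_nonneg_left husq (sq_nonneg a)]
  have h2 : ‖w'‖ ^ 2 ≤ ‖w‖ ^ 2 + 2 * a * ⟪w, h⟫_ℝ + 6 * a ^ 2 * (G ^ 2 * q ^ 2) := by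
    rw [hw', norm_add_sq_real, inner_smul_right, norm_smul, Real.norm_of_nonneg ha.le, mul_pow]
    linarith [mul_le_mul_of_nonneg_left (cross hwq hvh) ha.le,
      mul_le_mul_of_nonneg_left hvsq (sq_nonneg a)]
  have h3 : ⟪w', T e'⟫_ℝ ≤ ⟪w, T e⟫_ℝ + a * ⟪h, T e⟫_ℝ + a * G ^ 2 * ‖w‖ ^ 2 +
      6 * a ^ 2 * (G ^ 3 * q ^ 2) := by
    have e1 : ⟪w', T e'⟫_ℝ = ⟪w, T e⟫_ℝ + a * ⟪h, T e⟫_ℝ + a * ⟪v - h, T e⟫_ℝ +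
        ⟪w, T (e' - e)⟫_ℝ + a * ⟪v, T (e' - e)⟫_ℝ := by
      rw [hw']
      simp only [map_sub, inner_add_left, inner_sub_left, inner_sub_right, inner_smul_left,
        RCLike.conj_to_real]
      ring
    have e2 : ⟪v - h, T e⟫_ℝ ≤ a * (G ^ 3 * q ^ 2) := by
      have h1 := (abs_le.1 (abs_inner_map_le hT (v - h) e)).2
      have h2 : G * (‖v - h‖ * ‖e‖) ≤ G * (a * (G * q) * q) := by gcongr
      have h3 : a * (G ^ 2 * q ^ 2) ≤ a * (G ^ 3 * q ^ 2) := by gcongr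
      linarith
    -- Because of the projection, `e' - e` is known only in norm. Its first-order part is at most `a
    -- G ‖w‖`, since the primal oracle is bounded by a multiple of `‖w‖`; hence the cost is of order
    -- `‖w‖²` and involves no `‖e‖` at first order.
    have e3 : ⟪w, T (e' - e)⟫_ℝ ≤ a * G ^ 2 * ‖w‖ ^ 2 + a ^ 2 * (G ^ 3 * q ^ 2) := by
      have h1 := (abs_le.1 (abs_inner_map_le hT w (e' - e))).2
      have h2 : G * (‖w‖ * ‖e' - e‖) ≤ G * (‖w‖ * (a * (G * ‖w‖ + a * (G * q)))) := by
        gcongr; exact hee.trans (by gcongr)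
      have h3 : a ^ 2 * (G ^ 2 * (‖w‖ * q)) ≤ a ^ 2 * (G ^ 3 * (q * q)) := by gcongr
      linarith
    have e4 : ⟪v, T (e' - e)⟫_ℝ ≤ 4 * a * (G ^ 3 * q ^ 2) := by
      have h1 := (abs_le.1 (abs_inner_map_le hT v (e' - e))).2
      have h2 : G * (‖v‖ * ‖e' - e‖) ≤ G * (2 * (G * q) * (a * (2 * (G * q)))) := by
        gcongr; exact hee.trans (by gcongr)
      linarith
    linarith [mul_le_mul_of_nonneg_left e2 ha.le, mul_le_mul_of_nonneg_left e4 ha.le]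
  -- The constant 54 is `18 * 3`: the two squares and the cross term contribute 6 each, and the
  -- square of a sum of three terms contributes 3.
  have hqsq : q ^ 2 ≤ 3 * (n ^ 2 + (‖e‖ ^ 2 + ‖w‖ ^ 2)) := by
    rw [hq]
    nlinarith [sq_nonneg (n - ‖e‖), sq_nonneg (n - ‖w‖), sq_nonneg (‖e‖ - ‖w‖)]
  have h4 : c * (6 * a ^ 2 * (G ^ 3 * q ^ 2)) ≤ 6 * a ^ 2 * (G ^ 3 * q ^ 2) :=
    mul_le_of_le_one_left (by positivity) hc1
  have h5 : a ^ 2 * (G ^ 2 * q ^ 2) ≤ a ^ 2 * (G ^ 3 * q ^ 2) := by gcongr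
  have h6 : 18 * (a ^ 2 * G ^ 3) * q ^ 2 ≤
      18 * (a ^ 2 * G ^ 3) * (3 * (n ^ 2 + (‖e‖ ^ 2 + ‖w‖ ^ 2))) := by gcongr
  have h7 := mul_le_mul_of_nonneg_left h3 hc
  unfold lyapunov
  linarith

/-- The mean drift of the Lyapunov function is negative definite. -/
theorem drift_le {c G κ : ℝ} {T H : E →L[ℝ] E} (hκ : 1 ≤ κ) (hG : 1 ≤ G)
    (hT' : ∀ x, ‖x‖ ≤ κ * ‖T x‖) (hH : ∀ x, ‖H x‖ ≤ G * ‖x‖)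
    (hH' : ∀ x, ‖x‖ ^ 2 ≤ κ * ⟪x, H x⟫_ℝ) (hc : c = 1 / (2 * κ * G ^ 2)) (e w : E) :
    -(2 * ⟪w, H w⟫_ℝ) - c * ⟪T e + H w, T e⟫_ℝ + c * G ^ 2 * ‖w‖ ^ 2 ≤
      -(1 / (4 * κ ^ 3 * G ^ 2)) * (‖e‖ ^ 2 + ‖w‖ ^ 2) := by
  have hκ0 : 0 < κ := by linarith
  have hG0 : 0 < G := by linarith
  have hc0 : 0 < c := by rw [hc]; positivity
  -- This fixes `c`: the damping of `w` is worth `2‖w‖²/κ`, while the cross term costs `‖w‖²/(2κ)`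
  -- for the projection and `‖w‖²/(4κ)` from Young's inequality below, which keeps half of `c‖T
  -- e‖²`.
  have hcG : c * G ^ 2 = 1 / (2 * κ) := by rw [hc]; field_simp
  have h1 : ‖w‖ ^ 2 / κ ≤ ⟪w, H w⟫_ℝ := by
    rw [div_le_iff₀ hκ0]; linarith [hH' w]
  have h2 : -⟪H w, T e⟫_ℝ ≤ G ^ 2 * ‖w‖ ^ 2 / 2 + ‖T e‖ ^ 2 / 2 := by
    have := (abs_le.1 (abs_real_inner_le_norm (H w) (T e))).1
    have h3 : ‖H w‖ * ‖T e‖ ≤ G * ‖w‖ * ‖T e‖ := by gcongr; exact hH w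
    nlinarith [sq_nonneg (G * ‖w‖ - ‖T e‖)]
  have h3 : ‖e‖ ^ 2 / κ ^ 2 ≤ ‖T e‖ ^ 2 := by
    rw [div_le_iff₀ (by positivity), ← mul_pow, mul_comm]
    gcongr; exact hT' e
  have h4 : c / 2 * (‖e‖ ^ 2 / κ ^ 2) = 1 / (4 * κ ^ 3 * G ^ 2) * ‖e‖ ^ 2 := by
    rw [hc]; field_simp; ring
  have h5 : 1 / (4 * κ ^ 3 * G ^ 2) * ‖w‖ ^ 2 ≤ 1 / κ * ‖w‖ ^ 2 := by
    gcongr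
    have : 1 ≤ κ ^ 2 * G ^ 2 := by
      have := one_le_mul_of_one_le_of_one_le (one_le_pow₀ hκ (n := 2)) (one_le_pow₀ hG (n := 2))
      exact this
    nlinarith
  rw [inner_add_left, real_inner_self_eq_norm_sq]
  have h6 := mul_le_mul_of_nonneg_left h2 hc0.le
  have h7 := mul_le_mul_of_nonneg_left h3 (half_pos hc0).le
  have h8 : c * (G ^ 2 * ‖w‖ ^ 2 / 2) = 1 / κ * ‖w‖ ^ 2 / 4 := by
    rw [mul_div_assoc', ← mul_assoc, hcG]; field_simp; ring
  have h9 : c * G ^ 2 * ‖w‖ ^ 2 = 1 / κ * ‖w‖ ^ 2 / 2 := by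
    rw [hcG]; field_simp
  have h10 : ‖w‖ ^ 2 / κ = 1 / κ * ‖w‖ ^ 2 := by ring
  have h11 : 0 ≤ 1 / κ * ‖w‖ ^ 2 := by positivity
  nlinarith

end Lyapunov

end GradientTD

namespace GradientTD

/-- The continuous linear map on the Euclidean space given by a square matrix. -/
noncomputable abbrev matOp {d : ℕ} (B : Matrix (Fin d) (Fin d) ℝ) : Vec d →L[ℝ] Vec d :=
  Matrix.toEuclideanCLM (n := Fin d) (𝕜 := ℝ) B

theorem matOp_apply {d : ℕ} (B : Matrix (Fin d) (Fin d) ℝ) (x : Vec d) :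
    matOp B x = WithLp.toLp 2 (B *ᵥ x.ofLp) := rfl

/-- Injectivity is essential: the matrix inverse of a singular matrix is `0` by convention, so a
bound on the norm of `B⁻¹` alone carries no information. -/
theorem norm_le_specNorm_inv_mul {d : ℕ} {B : Matrix (Fin d) (Fin d) ℝ}
    (hB : Function.Injective B.mulVec) (x : Vec d) : ‖x‖ ≤ specNorm B⁻¹ * ‖matOp B x‖ := by
  have hdet : IsUnit B.det :=
    (Matrix.isUnit_iff_isUnit_det B).1 (Matrix.mulVec_injective_iff_isUnit.1 hB)
  have h : matOp B⁻¹ (matOp B x) = x := by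
    rw [matOp_apply, matOp_apply]
    simp [Matrix.mulVec_mulVec, Matrix.nonsing_inv_mul _ hdet]
  calc ‖x‖ = ‖matOp B⁻¹ (matOp B x)‖ := by rw [h]
    _ ≤ _ := ContinuousLinearMap.le_opNorm _ _

namespace Model

/-! ### The matrices `M` and `A`, the map `K`, and the value function -/

section Algebra

variable {S : Type*} [Fintype S] [DecidableEq S] {d : ℕ} (m : Model S d)

omit [DecidableEq S] in
theorem inner_φ (s : S) (x : Vec d) : ⟪m.φ s, x⟫_ℝ = (m.Φ *ᵥ x.ofLp) s := by
  simp [φ, PiLp.inner_apply, Matrix.mulVec, dotProduct, mul_comm]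

theorem inner_toLp_transpose (x : Vec d) (v : S → ℝ) :
    ⟪x, WithLp.toLp 2 ((m.Φᵀ * m.Ξ) *ᵥ v)⟫_ℝ = ∑ s, m.ξ s * ⟪m.φ s, x⟫_ℝ * v s := by
  rw [EuclideanSpace.inner_eq_star_dotProduct, star_trivial, dotProduct_comm,
    ← Matrix.mulVec_mulVec, Matrix.dotProduct_mulVec, Matrix.vecMul_transpose]
  simp only [dotProduct, inner_φ, Ξ, Matrix.mulVec_diagonal]
  exact Finset.sum_congr rfl fun s _ => by ring

omit [DecidableEq S] in
theorem P_mulVec_apply (v : S → ℝ) (s : S) : (m.P *ᵥ v) s = ∑ s', m.P s s' * v s' := rfl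

theorem M_mulVec (x : Fin d → ℝ) : m.M *ᵥ x = (m.Φᵀ * m.Ξ) *ᵥ (m.Φ *ᵥ x) := by
  rw [M, Matrix.mulVec_mulVec]

theorem A_mulVec (x : Fin d → ℝ) :
    m.A *ᵥ x = (m.Φᵀ * m.Ξ) *ᵥ (m.Φ *ᵥ x - m.γ • (m.P *ᵥ (m.Φ *ᵥ x))) := by
  rw [A, ← Matrix.mulVec_mulVec, Matrix.sub_mulVec, Matrix.smul_mulVec, Matrix.mulVec_mulVec x m.P]

theorem inner_M (x w : Vec d) :
    ⟪x, matOp m.M w⟫_ℝ = ∑ s, m.ξ s * (⟪m.φ s, x⟫_ℝ * ⟪m.φ s, w⟫_ℝ) := by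
  rw [matOp_apply, M_mulVec, inner_toLp_transpose]
  simp only [← inner_φ, mul_assoc]

theorem inner_A (x e : Vec d) :
    ⟪x, matOp m.A e⟫_ℝ =
      ∑ s, m.ξ s * (⟪m.φ s, x⟫_ℝ * (⟪m.φ s, e⟫_ℝ - m.γ * ∑ s', m.P s s' * ⟪m.φ s', e⟫_ℝ)) := by
  rw [matOp_apply, A_mulVec, inner_toLp_transpose]
  simp only [inner_φ, mul_assoc, Pi.sub_apply, Pi.smul_apply, smul_eq_mul, P_mulVec_apply]

theorem inner_K (x θ : Vec d) :
    ⟪x, m.K θ⟫_ℝ = ∑ s, m.ξ s * (⟪m.φ s, x⟫_ℝ *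
      (m.R s + m.γ * ∑ s', m.P s s' * ⟪m.φ s', θ⟫_ℝ - ⟪m.φ s, θ⟫_ℝ)) := by
  rw [K, inner_toLp_transpose, ← Matrix.mulVec_mulVec]
  simp only [inner_φ, mul_assoc, Pi.sub_apply, Pi.smul_apply, smul_eq_mul, P_mulVec_apply,
    Pi.add_apply]

theorem M_transpose : m.Mᵀ = m.M := by
  simp [M, Ξ, Matrix.transpose_mul, Matrix.mul_assoc]

/-! ### The Bellman equation -/

omit [DecidableEq S] in
theorem norm_P_mulVec_le (v : S → ℝ) : ‖m.P *ᵥ v‖ ≤ ‖v‖ := by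
  refine (pi_norm_le_iff_of_nonneg (norm_nonneg v)).2 fun s => ?_
  calc ‖(m.P *ᵥ v) s‖ ≤ ∑ s', ‖m.P s s' * v s'‖ := norm_sum_le _ _
    _ ≤ ∑ s', m.P s s' * ‖v‖ := Finset.sum_le_sum fun s' _ => by
      rw [norm_mul, Real.norm_of_nonneg (m.P_nonneg s s')]
      exact mul_le_mul_of_nonneg_left (norm_le_pi_norm v s') (m.P_nonneg s s')
    _ = ‖v‖ := by rw [← Finset.sum_mul, m.P_sum, one_mul]

theorem norm_P_pow_mulVec_le (v : S → ℝ) (i : ℕ) : ‖(m.P ^ i) *ᵥ v‖ ≤ ‖v‖ := by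
  induction i with
  | zero => simp
  | succ i ih =>
    rw [pow_succ', ← Matrix.mulVec_mulVec]
    exact (m.norm_P_mulVec_le _).trans ih

theorem hasSum_V (s : S) : HasSum (fun i : ℕ => m.γ ^ i * ((m.P ^ i) *ᵥ m.R) s) (m.V s) := by
  refine Summable.hasSum (Summable.of_norm_bounded (g := fun i => m.γ ^ i * ‖m.R‖)
    ((summable_geometric_of_lt_one m.γ_nonneg m.γ_lt_one).mul_right _) fun i => ?_)
  rw [norm_mul, norm_pow, Real.norm_of_nonneg m.γ_nonneg]
  exact mul_le_mul_of_nonneg_left ((norm_le_pi_norm _ s).trans (m.norm_P_pow_mulVec_le _ i))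
    (pow_nonneg m.γ_nonneg i)

/-- Removing the term `i = 0` from the defining series leaves `γ P` applied to the series. -/
theorem bellman (s : S) : m.V s = m.R s + m.γ * ∑ s', m.P s s' * m.V s' := by
  have h1 := (hasSum_sum fun (s' : S) (_ : s' ∈ Finset.univ) =>
    (m.hasSum_V s').mul_left (m.P s s')).mul_left m.γ
  have h2 : HasSum (fun i : ℕ => m.γ ^ (i + 1) * ((m.P ^ (i + 1)) *ᵥ m.R) s)
      (m.γ * ∑ s', m.P s s' * m.V s') := by
    refine h1.congr_fun (fun i => ?_)
    rw [pow_succ' m.P, ← Matrix.mulVec_mulVec, Matrix.mulVec, dotProduct, Finset.mul_sum,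
      Finset.mul_sum]
    exact Finset.sum_congr rfl fun s' _ => by ring
  have h3 := (hasSum_nat_add_iff' 1).2 (m.hasSum_V s)
  have h4 := h3.unique h2
  simp only [Finset.range_one, Finset.sum_singleton, pow_zero, one_mul, Matrix.one_mulVec] at h4
  linarith

/-! ### Invertibility of the two key matrices -/

omit [DecidableEq S] in
theorem Φ_injective (h : m.Φ.rank = d) : Function.Injective m.Φ.mulVec := by
  have h1 := LinearMap.finrank_range_add_finrank_ker m.Φ.mulVecLin
  rw [← Matrix.rank, h, Module.finrank_fin_fun] at h1
  have h2 : LinearMap.ker m.Φ.mulVecLin = ⊥ := Submodule.finrank_eq_zero.1 (by omega)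
  exact LinearMap.ker_eq_bot.1 h2

theorem inner_M_self_nonneg (x : Vec d) : 0 ≤ ⟪x, matOp m.M x⟫_ℝ := by
  rw [inner_M]
  exact Finset.sum_nonneg fun s _ => mul_nonneg (m.ξ_pos s).le (mul_self_nonneg _)

theorem M_injective (h : m.Φ.rank = d) : Function.Injective m.M.mulVec := by
  rw [← Matrix.coe_mulVecLin, ← LinearMap.ker_eq_bot, LinearMap.ker_eq_bot']
  intro x hx
  rw [Matrix.mulVecLin_apply] at hx
  have h1 := m.inner_M (WithLp.toLp 2 x) (WithLp.toLp 2 x)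
  rw [matOp_apply, hx, WithLp.toLp_zero, inner_zero_right, eq_comm,
    Finset.sum_eq_zero_iff_of_nonneg
      fun s _ => mul_nonneg (m.ξ_pos s).le (mul_self_nonneg _)] at h1
  refine m.Φ_injective h (funext fun s => ?_)
  have h2 := h1 s (Finset.mem_univ s)
  rw [mul_eq_zero, mul_self_eq_zero, or_iff_right (m.ξ_pos s).ne', inner_φ] at h2
  simpa using h2

theorem isUnit_det_M (h : m.Φ.rank = d) : IsUnit m.M.det :=
  (Matrix.isUnit_iff_isUnit_det _).1 (Matrix.mulVec_injective_iff_isUnit.1 (m.M_injective h))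

/-- If `A x = 0`, then `Π^Ξ` kills `Φ x - γ P Φ x`. It also fixes both terms, the second by
richness, so `Φ x = γ P Φ x`. As `P` does not increase the sup norm and `γ < 1`, `Φ x = 0`. -/
theorem A_injective (h : m.Φ.rank = d) (hr : m.Rich) : Function.Injective m.A.mulVec := by
  rw [← Matrix.coe_mulVecLin, ← LinearMap.ker_eq_bot, LinearMap.ker_eq_bot']
  intro x hx
  rw [Matrix.mulVecLin_apply, A_mulVec] at hx
  have hΦ : m.proj *ᵥ (m.Φ *ᵥ x) = m.Φ *ᵥ x := by
    rw [Matrix.mulVec_mulVec]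
    congr 1
    have : m.proj * m.Φ = m.Φ * (m.M⁻¹ * m.M) := by simp only [proj, M, Matrix.mul_assoc]
    rw [this, Matrix.nonsing_inv_mul _ (m.isUnit_det_M h), Matrix.mul_one]
  have hP : m.proj *ᵥ (m.P *ᵥ (m.Φ *ᵥ x)) = m.P *ᵥ (m.Φ *ᵥ x) := by
    rw [Matrix.mulVec_mulVec, hr.1]
  have h1 : m.proj *ᵥ (m.Φ *ᵥ x - m.γ • (m.P *ᵥ (m.Φ *ᵥ x))) = 0 := by
    have : m.proj = (m.Φ * m.M⁻¹) * (m.Φᵀ * m.Ξ) := by simp only [proj, Matrix.mul_assoc]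
    rw [this, ← Matrix.mulVec_mulVec, hx, Matrix.mulVec_zero]
  rw [Matrix.mulVec_sub, Matrix.mulVec_smul, hΦ, hP, sub_eq_zero] at h1
  have h2 : ‖m.Φ *ᵥ x‖ ≤ m.γ * ‖m.Φ *ᵥ x‖ := by
    calc ‖m.Φ *ᵥ x‖ = m.γ * ‖m.P *ᵥ (m.Φ *ᵥ x)‖ := by
          conv_lhs => rw [h1]
          rw [norm_smul, Real.norm_of_nonneg m.γ_nonneg]
      _ ≤ _ := mul_le_mul_of_nonneg_left (m.norm_P_mulVec_le _) m.γ_nonneg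
  have h3 : ‖m.Φ *ᵥ x‖ = 0 := by
    have := m.γ_lt_one
    nlinarith [norm_nonneg (m.Φ *ᵥ x)]
  refine m.Φ_injective h ?_
  rw [norm_eq_zero.1 h3, Matrix.mulVec_zero]

theorem norm_sq_le_inner_M (h : m.Φ.rank = d) {κ : ℝ} (hκ0 : 0 < κ) (hκ : specNorm m.M⁻¹ ≤ κ)
    (w : Vec d) : ‖w‖ ^ 2 ≤ κ * ⟪w, matOp m.M w⟫_ℝ := by
  have hdet := m.isUnit_det_M h
  set N := matOp m.M⁻¹
  have hMN : ∀ x, matOp m.M (N x) = x := fun x => by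
    simp [N, matOp_apply, Matrix.mulVec_mulVec, Matrix.mul_nonsing_inv _ hdet]
  have hsymm : ∀ x y, ⟪x, matOp m.M y⟫_ℝ = ⟪y, matOp m.M x⟫_ℝ := fun x y => by
    rw [inner_M, inner_M]; exact Finset.sum_congr rfl fun s _ => by ring
  have h1 : ⟪N w, w⟫_ℝ ≤ κ * ‖w‖ ^ 2 := by
    have h2 := real_inner_le_norm (N w) w
    have h3 : ‖N w‖ ≤ κ * ‖w‖ :=
      (ContinuousLinearMap.le_opNorm _ _).trans (mul_le_mul_of_nonneg_right hκ (norm_nonneg w))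
    nlinarith [norm_nonneg w]
  -- Positivity of `M` at `w - κ⁻¹ M⁻¹ w` expands to `⟪w, M w⟫ ≥ 2κ⁻¹‖w‖² - κ⁻²⟪M⁻¹ w, w⟫`, and the
  -- last term is at most `κ⁻¹‖w‖²`.
  have h2 := m.inner_M_self_nonneg (w - κ⁻¹ • N w)
  rw [map_sub, map_smul, hMN, inner_sub_left, inner_sub_right, inner_sub_right, inner_smul_left,
    inner_smul_left, hsymm (N w) w, hMN, inner_smul_right, inner_smul_right,
    real_inner_self_eq_norm_sq, RCLike.conj_to_real] at h2
  have h3 : κ⁻¹ * (κ⁻¹ * ⟪N w, w⟫_ℝ) ≤ κ⁻¹ * ‖w‖ ^ 2 := by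
    gcongr
    rw [inv_mul_le_iff₀ hκ0]; exact h1
  have h4 : κ⁻¹ * ‖w‖ ^ 2 ≤ ⟪w, matOp m.M w⟫_ℝ := by linarith
  rwa [inv_mul_le_iff₀ hκ0] at h4

theorem one_le_mul_specNorm_M (h : m.Φ.rank = d) (hd : 0 < d) {κ : ℝ} (hκ0 : 0 < κ)
    (hκ : specNorm m.M⁻¹ ≤ κ) : 1 ≤ κ * specNorm m.M := by
  have : Nonempty (Fin d) := ⟨⟨0, hd⟩⟩
  obtain ⟨w, hw⟩ := exists_norm_eq (Vec d) zero_le_one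
  have h1 := m.norm_sq_le_inner_M h hκ0 hκ w
  have h2 := real_inner_le_norm w (matOp m.M w)
  have h3 : ‖matOp m.M w‖ ≤ specNorm m.M * ‖w‖ := ContinuousLinearMap.le_opNorm _ _
  rw [hw] at *
  nlinarith

/-! ### The value error in terms of the parameter error -/

theorem Lφ_nonneg : 0 ≤ m.Lφ :=
  Real.iSup_nonneg fun _ => Finset.sum_nonneg fun _ _ => abs_nonneg _

/-- By symmetry of `M`, `φ(s)ᵀ x = (M⁻¹ φ(s))ᵀ (M x)`. Hölder's inequality between `ℓ¹` and `ℓ^∞`,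
with the sup norm below the Euclidean one, brings in `L_φ`. -/
theorem norm_approxV_le (h : m.Φ.rank = d) (x : Vec d) :
    ‖m.approxV x‖ ≤ m.Lφ * ‖matOp m.M x‖ := by
  refine (pi_norm_le_iff_of_nonneg (mul_nonneg m.Lφ_nonneg (norm_nonneg _))).2 fun s => ?_
  have h1 : m.approxV x s = (m.M⁻¹ *ᵥ m.Φ s) ⬝ᵥ (m.M *ᵥ x.ofLp) := by
    rw [Matrix.dotProduct_mulVec, ← Matrix.mulVec_transpose, M_transpose, Matrix.mulVec_mulVec,
      Matrix.mul_nonsing_inv _ (m.isUnit_det_M h), Matrix.one_mulVec]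
    rfl
  rw [h1, dotProduct]
  calc ‖∑ j, (m.M⁻¹ *ᵥ m.Φ s) j * (m.M *ᵥ x.ofLp) j‖
      ≤ ∑ j, ‖(m.M⁻¹ *ᵥ m.Φ s) j * (m.M *ᵥ x.ofLp) j‖ := norm_sum_le _ _
    _ ≤ ∑ j, |(m.M⁻¹ *ᵥ m.Φ s) j| * ‖matOp m.M x‖ := by
      refine Finset.sum_le_sum fun j _ => ?_
      rw [norm_mul, Real.norm_eq_abs]
      exact mul_le_mul_of_nonneg_left (PiLp.norm_apply_le (matOp m.M x) j) (abs_nonneg _)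
    _ = (∑ j, |(m.M⁻¹ *ᵥ m.Φ s) j|) * ‖matOp m.M x‖ := by rw [Finset.sum_mul]
    _ ≤ m.Lφ * ‖matOp m.M x‖ := by
      gcongr
      exact le_ciSup (f := fun s => ∑ j, |(m.M⁻¹ *ᵥ m.Φ s) j|) (Set.finite_range _).bddAbove s

/-- The Bellman equation says that the temporal difference error vanishes in mean at `θs`, so the
affine map `K` has only its linear part `-A` about `θs`. -/
theorem K_eq {θs : Vec d} (h : m.approxV θs = m.V) (θ : Vec d) :
    m.K θ = - matOp m.A (θ - θs) := by
  refine ext_inner_left ℝ fun x => ?_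
  rw [inner_neg_right, inner_K, inner_A, ← Finset.sum_neg_distrib]
  refine Finset.sum_congr rfl fun s _ => ?_
  have h1 := m.bellman s
  simp only [← h, approxV, ← inner_φ] at h1
  simp only [inner_sub_right, mul_sub, Finset.sum_sub_distrib] at h1 ⊢
  linear_combination (-(m.ξ s * ⟪m.φ s, x⟫_ℝ)) * h1

end Algebra

end Model
end GradientTD

namespace GradientTD
namespace Model

/-! ### Means and pathwise bounds of the stochastic oracles -/

section Expectation

variable {S : Type*} [Fintype S] [DecidableEq S] [MeasurableSpace S] [MeasurableSingletonClass S]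
  {d : ℕ} (m : Model S d) {Ω : Type*} [MeasurableSpace Ω] {μ : Measure Ω} [IsProbabilityMeasure μ]
  {Z : ℕ → Ω → Sample S}

/-- The stochastic oracle `(φ - γ φ') (φᵀ w)` for `Aᵀ w`. -/
noncomputable def coupling (z : Sample S) (w : Vec d) : Vec d :=
  ⟪m.φ z.1, w⟫_ℝ • (m.φ z.1 - m.γ • m.φ z.2.2)

variable {m}

omit [IsProbabilityMeasure μ] [DecidableEq S] [MeasurableSingletonClass S] in
theorem IsIIDSample.measurable_states (hZ : m.IsIIDSample μ Z) :
    Measurable fun ω => ((Z 0 ω).1, (Z 0 ω).2.2) :=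
  (measurable_fst.comp (hZ.measurable 0)).prodMk
    ((measurable_snd.comp measurable_snd).comp (hZ.measurable 0))

omit [DecidableEq S] in
theorem IsIIDSample.integrable_states (hZ : m.IsIIDSample μ Z) (f : S → S → ℝ) :
    Integrable (fun ω => f (Z 0 ω).1 (Z 0 ω).2.2) μ :=
  have := Measure.isProbabilityMeasure_map (μ := μ) hZ.measurable_states.aemeasurable
  (Integrable.of_finite (f := fun p : S × S => f p.1 p.2)).comp_measurable hZ.measurable_states

omit [DecidableEq S] in
theorem IsIIDSample.integral_states (hZ : m.IsIIDSample μ Z) (f : S → S → ℝ) :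
    ∫ ω, f (Z 0 ω).1 (Z 0 ω).2.2 ∂μ = ∑ s, m.ξ s * ∑ s', m.P s s' * f s s' := by
  have := Measure.isProbabilityMeasure_map (μ := μ) hZ.measurable_states.aemeasurable
  have h1 := integral_map (μ := μ) hZ.measurable_states.aemeasurable
    (f := fun p : S × S => f p.1 p.2) (Measurable.of_discrete).aestronglyMeasurable
  rw [← h1, integral_fintype Integrable.of_finite, Fintype.sum_prod_type]
  refine Finset.sum_congr rfl fun s _ => ?_
  rw [Finset.mul_sum]
  refine Finset.sum_congr rfl fun s' _ => ?_
  rw [map_measureReal_apply hZ.measurable_states (measurableSet_singleton _), smul_eq_mul,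
    ← mul_assoc, ← hZ.transition s s']
  congr 2
  ext ω
  simp [Prod.ext_iff]

omit [DecidableEq S] in
theorem IsIIDSample.integrable_reward_mul (hZ : m.IsIIDSample μ Z) (f : S → ℝ) :
    Integrable (fun ω => (Z 0 ω).2.1 * f (Z 0 ω).1) μ := by
  refine (hZ.reward_memLp.integrable one_le_two).mul_bdd (c := ‖f‖) ?_ ?_
  · exact ((Measurable.of_discrete (f := f)).comp
      (measurable_fst.comp (hZ.measurable 0))).aestronglyMeasurable
  · exact Filter.Eventually.of_forall fun ω => norm_le_pi_norm f _

omit [DecidableEq S] in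
theorem IsIIDSample.integral_reward_mul (hZ : m.IsIIDSample μ Z) (f : S → ℝ) :
    ∫ ω, (Z 0 ω).2.1 * f (Z 0 ω).1 ∂μ = ∑ s, m.ξ s * (m.R s * f s) := by
  have hm : ∀ s, MeasurableSet {ω | (Z 0 ω).1 = s} := fun s =>
    (measurable_fst.comp (hZ.measurable 0)) (measurableSet_singleton s)
  -- The conditional mean of the reward is given state by state, so the expectation is split over
  -- the value of the current state.
  have h1 : (fun ω => (Z 0 ω).2.1 * f (Z 0 ω).1) = fun ω => ∑ s, f s *
      ({ω | (Z 0 ω).1 = s}).indicator (fun ω => (Z 0 ω).2.1) ω := by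
    ext ω
    rw [Finset.sum_eq_single (Z 0 ω).1]
    · simp [mul_comm]
    · intro s _ hs
      simp [Set.indicator, hs.symm]
    · simp
  have hint := hZ.reward_memLp.integrable one_le_two
  rw [h1, integral_finsetSum _ fun s _ => (hint.indicator (hm s)).const_mul _]
  refine Finset.sum_congr rfl fun s _ => ?_
  rw [integral_const_mul, integral_indicator (hm s), hZ.reward_mean s]
  ring

omit [DecidableEq S] in
theorem IsIIDSample.integrable_inner_coupling (hZ : m.IsIIDSample μ Z) (x w : Vec d) :
    Integrable (fun ω => ⟪x, m.coupling (Z 0 ω) w⟫_ℝ) μ :=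
  hZ.integrable_states fun s s' => ⟪x, ⟪m.φ s, w⟫_ℝ • (m.φ s - m.γ • m.φ s')⟫_ℝ

theorem IsIIDSample.integral_inner_coupling (hZ : m.IsIIDSample μ Z) (x w : Vec d) :
    ∫ ω, ⟪x, m.coupling (Z 0 ω) w⟫_ℝ ∂μ = ⟪w, matOp m.A x⟫_ℝ := by
  refine (hZ.integral_states fun s s' =>
    ⟪x, ⟪m.φ s, w⟫_ℝ • (m.φ s - m.γ • m.φ s')⟫_ℝ).trans ?_
  rw [inner_A]
  refine Finset.sum_congr rfl fun s _ => ?_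
  have h : ∀ s', m.P s s' * ⟪x, ⟪m.φ s, w⟫_ℝ • (m.φ s - m.γ • m.φ s')⟫_ℝ =
      ⟪m.φ s, w⟫_ℝ * (m.P s s' * ⟪m.φ s, x⟫_ℝ) -
        ⟪m.φ s, w⟫_ℝ * m.γ * (m.P s s' * ⟪m.φ s', x⟫_ℝ) := fun s' => by
    rw [inner_smul_right, inner_sub_right, inner_smul_right, real_inner_comm x, real_inner_comm x]
    ring
  simp only [h]
  rw [Finset.sum_sub_distrib, ← Finset.mul_sum, ← Finset.mul_sum, ← Finset.sum_mul, m.P_sum]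
  ring

omit [DecidableEq S] in
theorem IsIIDSample.integrable_inner_oracleFgtd2 (hZ : m.IsIIDSample μ Z) (x w : Vec d) :
    Integrable (fun ω => ⟪x, m.oracleFgtd2 (Z 0 ω) w⟫_ℝ) μ :=
  hZ.integrable_states fun s _ => ⟪x, ⟪m.φ s, w⟫_ℝ • m.φ s⟫_ℝ

theorem IsIIDSample.integral_inner_oracleFgtd2 (hZ : m.IsIIDSample μ Z) (x w : Vec d) :
    ∫ ω, ⟪x, m.oracleFgtd2 (Z 0 ω) w⟫_ℝ ∂μ = ⟪x, matOp m.M w⟫_ℝ := by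
  refine (hZ.integral_states fun s _ => ⟪x, ⟪m.φ s, w⟫_ℝ • m.φ s⟫_ℝ).trans ?_
  rw [inner_M]
  refine Finset.sum_congr rfl fun s _ => ?_
  rw [← Finset.sum_mul, m.P_sum, inner_smul_right, real_inner_comm x]
  ring

omit [DecidableEq S] [MeasurableSpace S] [MeasurableSingletonClass S] in
theorem inner_oracleK (x θ : Vec d) (z : Sample S) :
    ⟪x, m.oracleK z θ⟫_ℝ = z.2.1 * ⟪m.φ z.1, x⟫_ℝ +
      (m.γ * ⟪m.φ z.2.2, θ⟫_ℝ - ⟪m.φ z.1, θ⟫_ℝ) * ⟪m.φ z.1, x⟫_ℝ := by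
  rw [oracleK, inner_smul_right, real_inner_comm x, tdError]
  ring

omit [DecidableEq S] in
theorem IsIIDSample.integrable_inner_oracleK (hZ : m.IsIIDSample μ Z) (x θ : Vec d) :
    Integrable (fun ω => ⟪x, m.oracleK (Z 0 ω) θ⟫_ℝ) μ := by
  simp only [inner_oracleK]
  exact (hZ.integrable_reward_mul fun s => ⟪m.φ s, x⟫_ℝ).add (hZ.integrable_states fun s s' =>
    (m.γ * ⟪m.φ s', θ⟫_ℝ - ⟪m.φ s, θ⟫_ℝ) * ⟪m.φ s, x⟫_ℝ)

theorem IsIIDSample.integral_inner_oracleK (hZ : m.IsIIDSample μ Z) (x θ : Vec d) :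
    ∫ ω, ⟪x, m.oracleK (Z 0 ω) θ⟫_ℝ ∂μ = ⟪x, m.K θ⟫_ℝ := by
  simp only [inner_oracleK]
  rw [integral_add (hZ.integrable_reward_mul fun s => ⟪m.φ s, x⟫_ℝ) (hZ.integrable_states fun s s' =>
    (m.γ * ⟪m.φ s', θ⟫_ℝ - ⟪m.φ s, θ⟫_ℝ) * ⟪m.φ s, x⟫_ℝ),
    hZ.integral_reward_mul fun s => ⟪m.φ s, x⟫_ℝ, hZ.integral_states fun s s' =>
    (m.γ * ⟪m.φ s', θ⟫_ℝ - ⟪m.φ s, θ⟫_ℝ) * ⟪m.φ s, x⟫_ℝ, inner_K, ← Finset.sum_add_distrib]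
  refine Finset.sum_congr rfl fun s _ => ?_
  have h : ∀ s', m.P s s' * ((m.γ * ⟪m.φ s', θ⟫_ℝ - ⟪m.φ s, θ⟫_ℝ) * ⟪m.φ s, x⟫_ℝ) =
      ⟪m.φ s, x⟫_ℝ * m.γ * (m.P s s' * ⟪m.φ s', θ⟫_ℝ) -
        m.P s s' * (⟪m.φ s, θ⟫_ℝ * ⟪m.φ s, x⟫_ℝ) := fun s' => by ring
  simp only [h]
  rw [Finset.sum_sub_distrib, ← Finset.mul_sum, ← Finset.sum_mul, m.P_sum]
  ring

omit [DecidableEq S] in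
theorem IsIIDSample.integrable_norm_oracleK_sq (hZ : m.IsIIDSample μ Z) (θ : Vec d) :
    Integrable (fun ω => ‖m.oracleK (Z 0 ω) θ‖ ^ 2) μ := by
  have hmeas := hZ.measurable 0
  have h1 : MemLp (fun ω => m.tdError (Z 0 ω) θ) 2 μ := by
    have h2 : MemLp (fun ω => m.γ * ⟪m.φ (Z 0 ω).2.2, θ⟫_ℝ - ⟪m.φ (Z 0 ω).1, θ⟫_ℝ) 2 μ := by
      rw [memLp_two_iff_integrable_sq]
      · exact hZ.integrable_states fun s s' => (m.γ * ⟪m.φ s', θ⟫_ℝ - ⟪m.φ s, θ⟫_ℝ) ^ 2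
      · exact (hZ.integrable_states fun s s' =>
          (m.γ * ⟪m.φ s', θ⟫_ℝ - ⟪m.φ s, θ⟫_ℝ)).aestronglyMeasurable
    convert hZ.reward_memLp.add h2 using 1
    ext ω
    simp only [tdError, Pi.add_apply]
    ring
  have h3 : Integrable (fun ω => m.tdError (Z 0 ω) θ ^ 2 * ‖m.φ (Z 0 ω).1‖ ^ 2) μ := by
    refine h1.integrable_sq.mul_bdd (c := ‖fun s => ‖m.φ s‖ ^ 2‖) ?_ ?_
    · exact ((Measurable.of_discrete (f := fun s => ‖m.φ s‖ ^ 2)).comp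
        (measurable_fst.comp hmeas)).aestronglyMeasurable
    · exact Filter.Eventually.of_forall fun ω => norm_le_pi_norm (fun s => ‖m.φ s‖ ^ 2) _
  refine h3.congr (Filter.Eventually.of_forall fun ω => ?_)
  simp only [oracleK, norm_smul, mul_pow, Real.norm_eq_abs, sq_abs]

/-! ### Norm bounds under bounded features -/

section Bounds

omit [MeasurableSpace S] [MeasurableSingletonClass S] [DecidableEq S]
variable {b : ℝ} (hφ : ∀ s, ‖m.φ s‖ ≤ b)
include hφ

theorem norm_φ_sub_le (s s' : S) : ‖m.φ s - m.γ • m.φ s'‖ ≤ 2 * b := by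
  refine (norm_sub_le _ _).trans ?_
  rw [norm_smul, Real.norm_of_nonneg m.γ_nonneg]
  have := mul_le_of_le_one_left (norm_nonneg (m.φ s')) m.γ_lt_one.le
  linarith [hφ s, hφ s']

theorem norm_coupling_le (z : Sample S) (w : Vec d) : ‖m.coupling z w‖ ≤ 2 * b ^ 2 * ‖w‖ := by
  have hb : 0 ≤ b := (norm_nonneg _).trans (hφ z.1)
  rw [coupling, norm_smul]
  calc ‖⟪m.φ z.1, w⟫_ℝ‖ * ‖m.φ z.1 - m.γ • m.φ z.2.2‖
      ≤ (b * ‖w‖) * (2 * b) := by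
        gcongr
        · exact (norm_inner_le_norm _ _).trans (by gcongr; exact hφ _)
        · exact norm_φ_sub_le hφ _ _
    _ = _ := by ring

theorem norm_oracleFgtd2_le (z : Sample S) (w : Vec d) : ‖m.oracleFgtd2 z w‖ ≤ b ^ 2 * ‖w‖ := by
  have hb : 0 ≤ b := (norm_nonneg _).trans (hφ z.1)
  rw [oracleFgtd2, norm_smul]
  calc ‖⟪m.φ z.1, w⟫_ℝ‖ * ‖m.φ z.1‖ ≤ (b * ‖w‖) * b := by
        gcongr
        · exact (norm_inner_le_norm _ _).trans (by gcongr; exact hφ _)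
        · exact hφ _
    _ = _ := by ring

theorem norm_oracleK_sub_le (z : Sample S) (θ θ' : Vec d) :
    ‖m.oracleK z θ - m.oracleK z θ'‖ ≤ 2 * b ^ 2 * ‖θ - θ'‖ := by
  have hb : 0 ≤ b := (norm_nonneg _).trans (hφ z.1)
  have h : m.oracleK z θ - m.oracleK z θ' =
      (-⟪m.φ z.1 - m.γ • m.φ z.2.2, θ - θ'⟫_ℝ) • m.φ z.1 := by
    rw [oracleK, oracleK, ← sub_smul]
    congr 1
    simp only [tdError, inner_sub_left, inner_sub_right, inner_smul_left, RCLike.conj_to_real]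
    ring
  rw [h, norm_smul, norm_neg]
  calc ‖⟪m.φ z.1 - m.γ • m.φ z.2.2, θ - θ'⟫_ℝ‖ * ‖m.φ z.1‖ ≤ ((2 * b) * ‖θ - θ'‖) * b := by
        gcongr
        · exact (norm_inner_le_norm _ _).trans (by gcongr; exact norm_φ_sub_le hφ _ _)
        · exact hφ _
    _ = _ := by ring

/-- Splits the noise into an additive part depending on the sample only and a part linear in the
distance to `θs`. -/
theorem norm_oracleK_le (z : Sample S) (θ θs : Vec d) :
    ‖m.oracleK z θ‖ ≤ ‖m.oracleK z θs‖ + 2 * b ^ 2 * ‖θ - θs‖ := by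
  have h := norm_add_le (m.oracleK z θs) (m.oracleK z θ - m.oracleK z θs)
  rw [add_sub_cancel] at h
  linarith [norm_oracleK_sub_le hφ z θ θs]

end Bounds

/-- `‖A x‖²` is the mean of `⟪x, (φ - γ φ') φᵀ w⟫` with `w = A x`, so the pathwise bound on the
oracle passes to its mean. -/
theorem IsIIDSample.norm_A_le (hZ : m.IsIIDSample μ Z) {b : ℝ} (hφ : ∀ s, ‖m.φ s‖ ≤ b)
    (x : Vec d) : ‖matOp m.A x‖ ≤ 2 * b ^ 2 * ‖x‖ := by
  set w := matOp m.A x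
  have h : ‖w‖ * ‖w‖ ≤ 2 * b ^ 2 * ‖x‖ * ‖w‖ := by
    calc ‖w‖ * ‖w‖ = ∫ ω, ⟪x, m.coupling (Z 0 ω) w⟫_ℝ ∂μ := by
          rw [hZ.integral_inner_coupling, ← sq, ← real_inner_self_eq_norm_sq]
      _ ≤ ∫ _, 2 * b ^ 2 * ‖x‖ * ‖w‖ ∂μ := by
          refine integral_mono (hZ.integrable_inner_coupling x w) (integrable_const _) fun ω => ?_
          refine (real_inner_le_norm _ _).trans ?_
          have := mul_le_mul_of_nonneg_left (norm_coupling_le hφ (Z 0 ω) w) (norm_nonneg x)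
          linarith
      _ = _ := by simp
  rcases (norm_nonneg w).eq_or_lt with h0 | h0
  · rw [← h0]; positivity
  · exact le_of_mul_le_mul_right h h0

theorem IsIIDSample.norm_M_le (hZ : m.IsIIDSample μ Z) {b : ℝ} (hφ : ∀ s, ‖m.φ s‖ ≤ b)
    (x : Vec d) : ‖matOp m.M x‖ ≤ b ^ 2 * ‖x‖ := by
  set w := matOp m.M x
  have h : ‖w‖ * ‖w‖ ≤ b ^ 2 * ‖x‖ * ‖w‖ := by
    calc ‖w‖ * ‖w‖ = ∫ ω, ⟪w, m.oracleFgtd2 (Z 0 ω) x⟫_ℝ ∂μ := by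
          rw [hZ.integral_inner_oracleFgtd2, ← sq, ← real_inner_self_eq_norm_sq]
      _ ≤ ∫ _, b ^ 2 * ‖x‖ * ‖w‖ ∂μ := by
          refine integral_mono (hZ.integrable_inner_oracleFgtd2 w x) (integrable_const _) fun ω => ?_
          refine (real_inner_le_norm _ _).trans ?_
          have := mul_le_mul_of_nonneg_left (norm_oracleFgtd2_le hφ (Z 0 ω) x) (norm_nonneg w)
          linarith
      _ = _ := by simp
  rcases (norm_nonneg w).eq_or_lt with h0 | h0
  · rw [← h0]; positivity
  · exact le_of_mul_le_mul_right h h0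

end Expectation

end Model
end GradientTD

namespace GradientTD

/-! ### Step sizes and the scalar recursion -/

section StepSize

/-- The exponential rate at which the mean dynamics contracts the Lyapunov function. -/
noncomputable def rate (G κ : ℝ) : ℝ := 1 / (4 * κ ^ 3 * G ^ 2)

/-- The time shift that makes the step sizes small enough from the start. -/
noncomputable def offset (G κ : ℝ) : ℝ := 1728 * G ^ 3 / rate G κ ^ 2

/-- The step size at time `t`. -/
noncomputable def stepSize (G κ : ℝ) (t : ℕ) : ℝ := 16 / (rate G κ * (t + offset G κ))

variable {G κ : ℝ}

theorem rate_pos (hG : 1 ≤ G) (hκ : 1 ≤ κ) : 0 < rate G κ := by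
  unfold rate; positivity

theorem rate_le_one (hG : 1 ≤ G) (hκ : 1 ≤ κ) : rate G κ ≤ 1 := by
  have h1 : 1 ≤ κ ^ 3 * G ^ 2 := one_le_mul_of_one_le_of_one_le (one_le_pow₀ hκ) (one_le_pow₀ hG)
  unfold rate
  rw [div_le_one (by positivity)]
  linarith

theorem four_le_offset (hG : 1 ≤ G) (hκ : 1 ≤ κ) : 4 ≤ offset G κ := by
  have h0 := rate_pos hG hκ
  have h1 : rate G κ ^ 2 ≤ 1 := pow_le_one₀ h0.le (rate_le_one hG hκ)
  have h2 : 1 ≤ G ^ 3 := one_le_pow₀ hG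
  unfold offset
  rw [le_div_iff₀ (by positivity)]
  linarith

theorem stepSize_pos (hG : 1 ≤ G) (hκ : 1 ≤ κ) (t : ℕ) : 0 < stepSize G κ t := by
  have h0 := rate_pos hG hκ
  have h1 := four_le_offset hG hκ
  unfold stepSize; positivity

/-- The condition under which the second-order terms use at most half of the drift. The offset is
`108 * 16 * G³ / rate²`, which makes it an equality at `t = 0`. -/
theorem stepSize_le (hG : 1 ≤ G) (hκ : 1 ≤ κ) (t : ℕ) :
    108 * G ^ 3 * stepSize G κ t ≤ rate G κ := by
  have h0 := rate_pos hG hκ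
  have h1 := four_le_offset hG hκ
  have h2 : 1728 * G ^ 3 = rate G κ * (rate G κ * offset G κ) := by
    unfold offset; field_simp
  have h3 : 0 ≤ rate G κ * (rate G κ * t) := by positivity
  unfold stepSize
  rw [mul_div_assoc', div_le_iff₀ (by positivity)]
  linarith

theorem stepSize_le_one (hG : 1 ≤ G) (hκ : 1 ≤ κ) (t : ℕ) : stepSize G κ t ≤ 1 := by
  have h0 := stepSize_le hG hκ t
  have h1 : 1 ≤ G ^ 3 := one_le_pow₀ hG
  have h2 := rate_le_one hG hκ
  nlinarith [stepSize_pos hG hκ t]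

/-- The numerator 16 yields the contraction factor `1 - 4/s`. The exponent 4 leaves `s⁻²`, which is
summable, after the square root. -/
theorem stepSize_mul_rate (hG : 1 ≤ G) (hκ : 1 ≤ κ) (t : ℕ) :
    stepSize G κ t * rate G κ / 4 = 4 / (t + offset G κ) := by
  have h0 := rate_pos hG hκ
  have h1 := four_le_offset hG hκ
  have h2 : 0 < t + offset G κ := by positivity
  unfold stepSize
  field_simp
  norm_num

theorem stepSize_sq (hG : 1 ≤ G) (hκ : 1 ≤ κ) (t : ℕ) :
    54 * G ^ 3 * stepSize G κ t ^ 2 = 8 * offset G κ / (t + offset G κ) ^ 2 := by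
  have h0 := rate_pos hG hκ
  have h1 := four_le_offset hG hκ
  have h2 : 0 < t + offset G κ := by positivity
  have h3 : 1728 * G ^ 3 = rate G κ ^ 2 * offset G κ := by
    unfold offset; field_simp
  have h4 : 54 * G ^ 3 = rate G κ ^ 2 * offset G κ / 32 := by linarith
  unfold stepSize
  rw [h4]
  field_simp
  norm_num

/-- The initial error decays like `s⁻⁴` by Bernoulli's inequality for `(1 - 1/(s+1))⁴`. The noise
part closes because `1/s - 3/s² ≤ 1/(s+1)`. -/
theorem recursion_bound_le {s : ℝ} (hs : 4 ≤ s) {a b : ℝ} (ha : 0 ≤ a) (hb : 0 ≤ b) :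
    (1 - 4 / s) * (a / s ^ 4 + b / s) + b / s ^ 2 ≤ a / (s + 1) ^ 4 + b / (s + 1) := by
  have hs0 : 0 < s := by linarith
  have h1 : (1 - 4 / s) * (1 / s ^ 4) ≤ 1 / (s + 1) ^ 4 := by
    have h2 := one_add_mul_le_pow (a := -(1 / (s + 1))) (by
      have : 1 / (s + 1) ≤ 1 := by rw [div_le_one (by positivity)]; linarith
      linarith) 4
    have h3 : 1 + -(1 / (s + 1)) = s / (s + 1) := by field_simp; ring
    rw [h3] at h2
    have h4 : 4 / (s + 1) ≤ 4 / s := by gcongr; linarith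
    have h5 : 1 - 4 / s ≤ (s / (s + 1)) ^ 4 := by
      refine le_trans ?_ h2
      have : ((4 : ℕ) : ℝ) * -(1 / (s + 1)) = -(4 / (s + 1)) := by push_cast; ring
      rw [this]; linarith
    calc (1 - 4 / s) * (1 / s ^ 4) ≤ (s / (s + 1)) ^ 4 * (1 / s ^ 4) := by gcongr
      _ = _ := by field_simp
  have h2 : (1 - 4 / s) * (1 / s) + 1 / s ^ 2 ≤ 1 / (s + 1) := by
    have h3 : 1 / s - 1 / s ^ 2 ≤ 1 / (s + 1) := by
      rw [div_sub_div _ _ (by positivity) (by positivity), div_le_div_iff₀ (by positivity)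
        (by positivity)]
      nlinarith
    have h4 : (1 - 4 / s) * (1 / s) + 1 / s ^ 2 = 1 / s - 1 / s ^ 2 - 2 * (1 / s ^ 2) := by
      field_simp; ring
    have h5 : 0 ≤ 1 / s ^ 2 := by positivity
    linarith
  have h3 := mul_le_mul_of_nonneg_left h1 ha
  have h4 := mul_le_mul_of_nonneg_left h2 hb
  calc _ = a * ((1 - 4 / s) * (1 / s ^ 4)) + b * ((1 - 4 / s) * (1 / s) + 1 / s ^ 2) := by ring
    _ ≤ a * (1 / (s + 1) ^ 4) + b * (1 / (s + 1)) := add_le_add h3 h4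
    _ = _ := by ring

theorem sum_one_div_sq_le (N : ℕ) : ∑ t ∈ Finset.range N, 1 / ((t : ℝ) + 1) ^ 2 ≤ 2 := by
  -- The strengthened claim telescopes. At `N = 0` it reads `0 ≤ 2`, as `1/0 = 0`; for the same
  -- reason the first increment is checked separately.
  suffices h : ∑ t ∈ Finset.range N, 1 / ((t : ℝ) + 1) ^ 2 ≤ 2 - 1 / (N : ℝ) by
    have : (0 : ℝ) ≤ 1 / N := by positivity
    linarith
  induction N with
  | zero => simp
  | succ N ih =>
    rw [Finset.sum_range_succ]
    rcases N.eq_zero_or_pos with rfl | hN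
    · norm_num
    · have hN' : (0 : ℝ) < N := by exact_mod_cast hN
      have h1 : 1 / ((N : ℝ) + 1) ^ 2 ≤ 1 / N - 1 / (N + 1) := by
        rw [div_sub_div _ _ (by positivity) (by positivity), div_le_div_iff₀ (by positivity)
          (by positivity)]
        nlinarith
      push_cast
      linarith

theorem sum_one_div_sqrt_le (N : ℕ) : ∑ t ∈ Finset.range N, 1 / √((t : ℝ) + 1) ≤ 2 * √N := by
  induction N with
  | zero => simp
  | succ N ih =>
    rw [Finset.sum_range_succ]
    push_cast
    have h0 : 0 < √((N : ℝ) + 1) := Real.sqrt_pos.2 (by positivity)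
    have h1 : √((N : ℝ) + 1) ^ 2 = N + 1 := Real.sq_sqrt (by positivity)
    have h2 : √(N : ℝ) ^ 2 = N := Real.sq_sqrt (by positivity)
    have h3 : 1 / √((N : ℝ) + 1) ≤ 2 * (√((N : ℝ) + 1) - √N) := by
      rw [div_le_iff₀ h0]
      nlinarith [sq_nonneg (√((N : ℝ) + 1) - √N)]
    linarith

end StepSize

/-! ### Abstract saddle oracles and the mean decrease in one step -/

section Recursion

variable {E : Type*} [NormedAddCommGroup E] [InnerProductSpace ℝ E] {𝒵 Ω : Type*}
  [MeasurableSpace Ω]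

/-- Stochastic oracles `g`, `h` for the saddle point problem with coupling `T` and dual Hessian `H`
and with primal solution `θs`, with a uniform bound `G` on the multiplicative part of the noise and
with additive noise `n` of variance at most `σ²`. -/
structure IsSaddleOracle (μ : Measure Ω) (ζ : Ω → 𝒵) (T H : E →L[ℝ] E) (κ G σ : ℝ) (θs : E)
    (g : 𝒵 → E → E) (h : 𝒵 → E → E → E) (n : 𝒵 → ℝ) : Prop where
  one_le_κ : 1 ≤ κ
  one_le_G : 1 ≤ G
  norm_T_le : ∀ x, ‖T x‖ ≤ G * ‖x‖
  le_norm_T : ∀ x, ‖x‖ ≤ κ * ‖T x‖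
  norm_H_le : ∀ x, ‖H x‖ ≤ G * ‖x‖
  le_inner_H : ∀ x, ‖x‖ ^ 2 ≤ κ * ⟪x, H x⟫_ℝ
  norm_g_le : ∀ z w, ‖g z w‖ ≤ G * ‖w‖
  norm_h_le : ∀ z θ w, ‖h z θ w‖ ≤ G * (n z + ‖θ - θs‖ + ‖w‖)
  n_nonneg : ∀ z, 0 ≤ n z
  integrable_g : ∀ x w, Integrable (fun ω => ⟪x, g (ζ ω) w⟫_ℝ) μ
  integral_g : ∀ x w, ∫ ω, ⟪x, g (ζ ω) w⟫_ℝ ∂μ = ⟪w, T x⟫_ℝ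
  integrable_h : ∀ x θ w, Integrable (fun ω => ⟪x, h (ζ ω) θ w⟫_ℝ) μ
  integral_h : ∀ x θ w, ∫ ω, ⟪x, h (ζ ω) θ w⟫_ℝ ∂μ = -⟪x, T (θ - θs) + H w⟫_ℝ
  integrable_n : Integrable (fun ω => n (ζ ω) ^ 2) μ
  integral_n_le : ∫ ω, n (ζ ω) ^ 2 ∂μ ≤ σ ^ 2

/-- A step of size `a` along the oracles `g`, `h`, projected to `X` in the primal variable, up to
perturbations of second order in `a`. -/
structure IsPerturbedStep (X : Set E) (G a : ℝ) (θs : E) (g : 𝒵 → E → E) (h : 𝒵 → E → E → E)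
    (n : 𝒵 → ℝ) (step : 𝒵 → E × E → E × E) : Prop where
  mem : ∀ z x, (step z x).1 ∈ X
  dual : ∀ z x, x.1 ∈ X → ‖(step z x).2 - (x.2 + a • h z x.1 x.2)‖ ≤
    a ^ 2 * (G * (n z + ‖x.1 - θs‖ + ‖x.2‖))
  primal : ∀ z x, x.1 ∈ X → ∃ u, ‖u - g z x.2‖ ≤ a * (G * (n z + ‖x.1 - θs‖ + ‖x.2‖)) ∧
    ‖(step z x).1 - θs‖ ≤ ‖x.1 - θs + a • u‖ ∧ ‖(step z x).1 - x.1‖ ≤ a * ‖u‖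

variable {μ : Measure Ω} [IsProbabilityMeasure μ] {ζ : Ω → 𝒵} {T H : E →L[ℝ] E} {κ G σ : ℝ}
  {θs : E} {g : 𝒵 → E → E} {h : 𝒵 → E → E → E} {n : 𝒵 → ℝ}

/-- The weight of the cross term in the Lyapunov function. -/
noncomputable def crossWeight (G κ : ℝ) : ℝ := 1 / (2 * κ * G ^ 2)

theorem crossWeight_nonneg (hG : 1 ≤ G) (hκ : 1 ≤ κ) : 0 ≤ crossWeight G κ := by
  unfold crossWeight; positivity

theorem crossWeight_mul_le (hG : 1 ≤ G) (hκ : 1 ≤ κ) : crossWeight G κ * G ≤ 1 / 2 := by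
  have h1 : 1 ≤ κ * G := one_le_mul_of_one_le_of_one_le hκ hG
  have h2 : crossWeight G κ * G = 1 / (2 * (κ * G)) := by
    unfold crossWeight; field_simp
  rw [h2]
  gcongr
  linarith

/-- The one-step decrease in mean of the Lyapunov function. -/
theorem IsSaddleOracle.lintegral_lyapunov_le (ho : IsSaddleOracle μ ζ T H κ G σ θs g h n)
    {X : Set E} {a : ℝ} {step : 𝒵 → E × E → E × E} (hst : IsPerturbedStep X G a θs g h n step)
    (ha : 0 < a) (ha1 : a ≤ 1) (haG : 108 * G ^ 3 * a ≤ rate G κ) (x : E × E) (hx : x.1 ∈ X) :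
    ∫⁻ ω, ENNReal.ofReal (lyapunov (crossWeight G κ) T ((step (ζ ω) x).1 - θs) (step (ζ ω) x).2) ∂μ
      ≤ ENNReal.ofReal ((1 - a * rate G κ / 4) *
        lyapunov (crossWeight G κ) T (x.1 - θs) x.2 + 54 * G ^ 3 * a ^ 2 * σ ^ 2) := by
  have hG := ho.one_le_G
  have hκ := ho.one_le_κ
  have hc0 := crossWeight_nonneg hG hκ
  have hcG := crossWeight_mul_le hG hκ
  have hc1 : crossWeight G κ ≤ 1 := by nlinarith
  set c := crossWeight G κ with hc
  set w := x.2
  set e := x.1 - θs with he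
  set L := lyapunov c T e w with hL
  have hint1 := ho.integrable_g e w
  have hint2 := ho.integrable_h w x.1 w
  have hint3 := ho.integrable_h (T e) x.1 w
  have hint4 := ho.integrable_n
  -- `F` is the pathwise bound on the new Lyapunov value, affine in the oracles and in `n²`, so its
  -- mean is explicit. Using the lower integral for the Lyapunov value avoids any integrability
  -- requirement on it.
  set F : Ω → ℝ := fun ω => (L + a * (c * G ^ 2 * ‖w‖ ^ 2) + 54 * G ^ 3 * a ^ 2 *
      (‖e‖ ^ 2 + ‖w‖ ^ 2)) + (a * 2) * ⟪e, g (ζ ω) w⟫_ℝ + (a * 2) * ⟪w, h (ζ ω) x.1 w⟫_ℝ +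
      (a * c) * ⟪T e, h (ζ ω) x.1 w⟫_ℝ + (54 * G ^ 3 * a ^ 2) * n (ζ ω) ^ 2 with hF
  have i1 := (integrable_const (μ := μ) (L + a * (c * G ^ 2 * ‖w‖ ^ 2) + 54 * G ^ 3 * a ^ 2 *
      (‖e‖ ^ 2 + ‖w‖ ^ 2))).add (hint1.const_mul (a * 2))
  have i2 := i1.add (hint2.const_mul (a * 2))
  have i3 := i2.add (hint3.const_mul (a * c))
  have hFint : Integrable F μ := i3.add (hint4.const_mul (54 * G ^ 3 * a ^ 2))
  have hle : ∀ ω, lyapunov c T ((step (ζ ω) x).1 - θs) (step (ζ ω) x).2 ≤ F ω := by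
    intro ω
    obtain ⟨u, hu1, hu2, hu3⟩ := hst.primal (ζ ω) x hx
    have := lyapunov_step_le ho.norm_T_le hc0 hc1 hG ha ha1 (ho.n_nonneg (ζ ω))
      (ho.norm_g_le (ζ ω) w) (ho.norm_h_le (ζ ω) x.1 w) hu1 hu2
      (by rwa [sub_sub_sub_cancel_right]) (hst.dual (ζ ω) x hx)
    rw [real_inner_comm (T e)] at this
    simp only [hF]
    linarith
  have hFnn : 0 ≤ᵐ[μ] F := Filter.Eventually.of_forall fun ω =>
    (le_trans (by positivity) (le_lyapunov ho.norm_T_le hc0 hcG _ _)).trans (hle ω)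
  calc _ ≤ ∫⁻ ω, ENNReal.ofReal (F ω) ∂μ :=
        lintegral_mono fun ω => ENNReal.ofReal_le_ofReal (hle ω)
    _ = ENNReal.ofReal (∫ ω, F ω ∂μ) := (ofReal_integral_eq_lintegral_ofReal hFint hFnn).symm
    _ ≤ _ := ENNReal.ofReal_le_ofReal ?_
  have hmean : ∫ ω, F ω ∂μ = (L + a * (c * G ^ 2 * ‖w‖ ^ 2) + 54 * G ^ 3 * a ^ 2 *
      (‖e‖ ^ 2 + ‖w‖ ^ 2)) + (a * 2) * ⟪w, T e⟫_ℝ + (a * 2) * (-⟪w, T e + H w⟫_ℝ) +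
      (a * c) * (-⟪T e, T e + H w⟫_ℝ) + (54 * G ^ 3 * a ^ 2) * ∫ ω, n (ζ ω) ^ 2 ∂μ := by
    have hsum := integral_add i3 (hint4.const_mul (54 * G ^ 3 * a ^ 2))
    rw [integral_add' i2 (hint3.const_mul _), integral_add' i1 (hint2.const_mul _),
      integral_add' (integrable_const _) (hint1.const_mul _),
      integral_const_mul, integral_const_mul, integral_const_mul, integral_const_mul,
      ho.integral_g, ho.integral_h, ho.integral_h, integral_const, probReal_univ, one_smul] at hsum
    exact hsum
  have hdrift := mul_le_mul_of_nonneg_left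
    (drift_le (c := c) hκ hG ho.le_norm_T ho.norm_H_le ho.le_inner_H rfl e w) ha.le
  have hn := mul_le_mul_of_nonneg_left ho.integral_n_le
    (show 0 ≤ 54 * G ^ 3 * a ^ 2 by positivity)
  -- The second-order term takes half of the drift. The other half, `a * rate / 2` times the squared
  -- distance, is at least `a * rate / 4` times the Lyapunov value.
  have hsq : 54 * G ^ 3 * a ^ 2 * (‖e‖ ^ 2 + ‖w‖ ^ 2) ≤
      a * (rate G κ / 2) * (‖e‖ ^ 2 + ‖w‖ ^ 2) := by
    refine mul_le_mul_of_nonneg_right ?_ (by positivity)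
    linarith [mul_le_mul_of_nonneg_left haG ha.le]
  have hLU := mul_le_mul_of_nonneg_left (lyapunov_le ho.norm_T_le hc0 hcG e w)
    (show 0 ≤ a * rate G κ / 4 by have := rate_pos hG hκ; positivity)
  rw [← hL] at hLU
  rw [← rate] at hdrift
  rw [hmean, real_inner_comm (T e + H w) (T e), inner_add_right]
  linarith

end Recursion

end GradientTD

namespace GradientTD

/-! ### From one step to the averaged iterates -/

section Iteration

variable {𝒵 Ω 𝒮 : Type*} [MeasurableSpace 𝒵] [MeasurableSpace Ω] [MeasurableSpace 𝒮]

omit [MeasurableSpace Ω] in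
/-- The iterates of a random recursion are measurable functions of the past samples. -/
theorem exists_measurable_history {Z : ℕ → Ω → 𝒵} {step : ℕ → 𝒵 → 𝒮 → 𝒮}
    (hstep : ∀ t, Measurable fun p : 𝒵 × 𝒮 => step t p.1 p.2) {x : ℕ → Ω → 𝒮} {x₀ : 𝒮}
    (h0 : ∀ ω, x 0 ω = x₀) (hx : ∀ t ω, x (t + 1) ω = step t (Z t ω) (x t ω)) (t : ℕ) :
    ∃ ψ : (Finset.range t → 𝒵) → 𝒮, Measurable ψ ∧ ∀ ω, x t ω = ψ fun i => Z i ω := by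
  induction t with
  | zero => exact ⟨fun _ => x₀, measurable_const, h0⟩
  | succ t ih =>
    obtain ⟨ψ, hψ, hψx⟩ := ih
    have hsub : ∀ i : Finset.range t, (i : ℕ) ∈ Finset.range (t + 1) := fun i =>
      Finset.mem_range.2 ((Finset.mem_range.1 i.2).trans t.lt_succ_self)
    have hm : Measurable fun z : Finset.range (t + 1) → 𝒵 =>
        (z ⟨t, Finset.self_mem_range_succ t⟩, ψ fun i => z ⟨i, hsub i⟩) :=
      (measurable_pi_apply _).prodMk
        (hψ.comp (measurable_pi_lambda _ fun i => measurable_pi_apply _))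
    exact ⟨_, (hstep t).comp hm, fun ω => by rw [hx, hψx]; rfl⟩

variable {μ : Measure Ω} [IsProbabilityMeasure μ]

/-- Averaging over a new sample, given the current iterate of a random recursion. -/
theorem lintegral_comp_iterate {Z : ℕ → Ω → 𝒵} (hZ : ∀ t, Measurable (Z t)) (hind : iIndepFun Z μ)
    (hid : ∀ t, IdentDistrib (Z t) (Z 0) μ μ) {step : ℕ → 𝒵 → 𝒮 → 𝒮}
    (hstep : ∀ t, Measurable fun p : 𝒵 × 𝒮 => step t p.1 p.2) {x : ℕ → Ω → 𝒮} {x₀ : 𝒮}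
    (h0 : ∀ ω, x 0 ω = x₀) (hx : ∀ t ω, x (t + 1) ω = step t (Z t ω) (x t ω)) (t : ℕ)
    {f : 𝒮 → ENNReal} (hf : Measurable f) :
    ∫⁻ ω, f (x (t + 1) ω) ∂μ = ∫⁻ ω, ∫⁻ ω', f (step t (Z 0 ω') (x t ω)) ∂μ ∂μ := by
  obtain ⟨ψ, hψ, hψx⟩ := exists_measurable_history hstep h0 hx t
  have hmx : Measurable (x t) := by
    rw [funext hψx]
    exact hψ.comp (measurable_pi_lambda _ fun i => hZ i)
  -- The iterate is a function of the samples with index below `t`, hence independent of the sample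
  -- `Z t`; the joint law is then a product and Tonelli applies.
  have hindep : IndepFun (x t) (Z t) μ := by
    have h1 := hind.indepFun_finset (Finset.range t) {t} (by simp) hZ
    have h2 := h1.comp hψ (measurable_pi_apply (⟨t, Finset.mem_singleton_self t⟩ :
      ({t} : Finset ℕ)))
    rw [funext hψx]
    exact h2
  have hF : Measurable fun p : 𝒮 × 𝒵 => f (step t p.2 p.1) :=
    hf.comp ((hstep t).comp measurable_swap)
  calc ∫⁻ ω, f (x (t + 1) ω) ∂μ
      = ∫⁻ p, f (step t p.2 p.1) ∂(μ.map fun ω => (x t ω, Z t ω)) := by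
        rw [lintegral_map hF (hmx.prodMk (hZ t))]
        simp only [hx]
    _ = ∫⁻ s, ∫⁻ z, f (step t z s) ∂(μ.map (Z t)) ∂(μ.map (x t)) := by
        have := Measure.isProbabilityMeasure_map (μ := μ) (hZ t).aemeasurable
        rw [hindep.map_prod_eq_prod_map_map hmx.aemeasurable (hZ t).aemeasurable,
          lintegral_prod _ hF.aemeasurable]
    _ = ∫⁻ ω, ∫⁻ z, f (step t z (x t ω)) ∂(μ.map (Z t)) ∂μ := by
        have := Measure.isProbabilityMeasure_map (μ := μ) (hZ t).aemeasurable
        rw [lintegral_map hF.lintegral_prod_right' hmx]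
    _ = _ := by
        refine lintegral_congr fun ω => ?_
        have hm : Measurable fun z => f (step t z (x t ω)) := hF.comp measurable_prodMk_left
        rw [(hid t).map_eq, lintegral_map hm (hZ 0)]

/-- A finite second moment gives integrability on a probability space, and nonnegativity of the
variance bounds the mean. -/
theorem integral_le_sqrt_of_lintegral_sq_le {f : Ω → ℝ} (hf : Measurable f) {β : ℝ}
    (h : ∫⁻ ω, ENNReal.ofReal (f ω ^ 2) ∂μ ≤ ENNReal.ofReal β) :
    Integrable f μ ∧ ∫ ω, f ω ∂μ ≤ √β := by
  have hsq : Integrable (fun ω => f ω ^ 2) μ := by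
    refine ⟨(hf.pow_const 2).aestronglyMeasurable, ?_⟩
    rw [hasFiniteIntegral_iff_ofReal (Filter.Eventually.of_forall fun ω => sq_nonneg _)]
    exact h.trans_lt ENNReal.ofReal_lt_top
  have hLp : MemLp f 2 μ := (memLp_two_iff_integrable_sq hf.aestronglyMeasurable).2 hsq
  have hint := hLp.integrable one_le_two
  refine ⟨hint, ?_⟩
  rcases le_or_gt β 0 with hβ | hβ
  · rw [ENNReal.ofReal_of_nonpos hβ, nonpos_iff_eq_zero,
      lintegral_eq_zero_iff (by fun_prop)] at h
    have : f =ᵐ[μ] 0 := by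
      filter_upwards [h] with ω hω
      simpa using le_antisymm (ENNReal.ofReal_eq_zero.1 hω) (sq_nonneg (f ω))
    rw [integral_congr_ae this]
    simp
  · rw [← ofReal_integral_eq_lintegral_ofReal hsq
      (Filter.Eventually.of_forall fun ω => sq_nonneg _), ENNReal.ofReal_le_ofReal_iff hβ.le] at h
    refine Real.le_sqrt_of_sq_le (le_trans ?_ h)
    have h1 := variance_nonneg f μ
    rw [variance_eq_sub hLp] at h1
    simp only [Pi.pow_apply] at h1
    linarith

variable {d : ℕ} {X : Set (Vec d)} {T H : Vec d →L[ℝ] Vec d} {κ G σ D : ℝ} {θs : Vec d}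
  {g : 𝒵 → Vec d → Vec d} {h : 𝒵 → Vec d → Vec d → Vec d} {n : 𝒵 → ℝ}
  {Z : ℕ → Ω → 𝒵} {step : ℕ → 𝒵 → Vec d × Vec d → Vec d × Vec d}
  {x : ℕ → Ω → Vec d × Vec d} {x₀ : Vec d × Vec d}

theorem measurable_iterate (hZ : ∀ t, Measurable (Z t))
    (hstep : ∀ t, Measurable fun p : 𝒵 × (Vec d × Vec d) => step t p.1 p.2)
    (h0 : ∀ ω, x 0 ω = x₀) (hx : ∀ t ω, x (t + 1) ω = step t (Z t ω) (x t ω)) (t : ℕ) :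
    Measurable (x t) := by
  obtain ⟨ψ, hψ, hψx⟩ := exists_measurable_history hstep h0 hx t
  rw [funext hψx]
  exact hψ.comp (measurable_pi_lambda _ fun i => hZ i)

theorem measurable_lyapunov (c : ℝ) (T : Vec d →L[ℝ] Vec d) (θs : Vec d) :
    Measurable fun p : Vec d × Vec d => lyapunov c T (p.1 - θs) p.2 := by
  unfold lyapunov
  exact Continuous.measurable (by fun_prop)

theorem measurable_lyapunov_iterate (hZ : ∀ t, Measurable (Z t))
    (hstep : ∀ t, Measurable fun p : 𝒵 × (Vec d × Vec d) => step t p.1 p.2)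
    (h0 : ∀ ω, x 0 ω = x₀) (hx : ∀ t ω, x (t + 1) ω = step t (Z t ω) (x t ω)) (c : ℝ)
    (T : Vec d →L[ℝ] Vec d) (θs : Vec d) (t : ℕ) :
    Measurable fun ω => ENNReal.ofReal (lyapunov c T ((x t ω).1 - θs) (x t ω).2) :=
  (measurable_lyapunov c T θs).ennreal_ofReal.comp (measurable_iterate hZ hstep h0 hx t)

/-- Induction on `t` with the scalar recursion at `s = t + offset`. Initially each squared norm is
at most `D²` and the Lyapunov value at most twice their sum, hence `4 D²`. -/
theorem lintegral_lyapunov_iterate_le (hZ : ∀ t, Measurable (Z t)) (hind : iIndepFun Z μ)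
    (hid : ∀ t, IdentDistrib (Z t) (Z 0) μ μ)
    (hstep : ∀ t, Measurable fun p : 𝒵 × (Vec d × Vec d) => step t p.1 p.2)
    (h0 : ∀ ω, x 0 ω = x₀) (hx : ∀ t ω, x (t + 1) ω = step t (Z t ω) (x t ω))
    (ho : IsSaddleOracle μ (Z 0) T H κ G σ θs g h n)
    (hst : ∀ t, IsPerturbedStep X G (stepSize G κ t) θs g h n (step t))
    (hx₀ : x₀.1 ∈ X) (hD : ‖x₀.1 - θs‖ ≤ D) (hD' : ‖x₀.2‖ ≤ D) (t : ℕ) :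
    ∫⁻ ω, ENNReal.ofReal (lyapunov (crossWeight G κ) T ((x t ω).1 - θs) (x t ω).2) ∂μ ≤
      ENNReal.ofReal (4 * D ^ 2 * offset G κ ^ 4 / (t + offset G κ) ^ 4 +
        8 * offset G κ * σ ^ 2 / (t + offset G κ)) := by
  have hG := ho.one_le_G
  have hκ := ho.one_le_κ
  have ht0 := four_le_offset hG hκ
  have hc0 := crossWeight_nonneg hG hκ
  have hcG := crossWeight_mul_le hG hκ
  have hmem : ∀ t ω, (x t ω).1 ∈ X := by
    rintro (_ | t) ω
    · rwa [h0]
    · rw [hx]; exact (hst t).mem _ _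
  induction t with
  | zero =>
    simp only [h0, lintegral_const, measure_univ, mul_one, Nat.cast_zero, zero_add]
    refine ENNReal.ofReal_le_ofReal ((lyapunov_le ho.norm_T_le hc0 hcG _ _).trans ?_)
    have h1 : ‖x₀.1 - θs‖ ^ 2 ≤ D ^ 2 := by gcongr
    have h2 : ‖x₀.2‖ ^ 2 ≤ D ^ 2 := by gcongr
    have h3 : 0 ≤ 8 * offset G κ * σ ^ 2 / offset G κ := by positivity
    rw [mul_div_assoc, div_self (by positivity)]
    linarith
  | succ t ih =>
    set s : ℝ := t + offset G κ with hs
    have hs4 : 4 ≤ s := by rw [hs]; linarith [(Nat.cast_nonneg t : (0 : ℝ) ≤ t)]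
    have hss : ((t + 1 : ℕ) : ℝ) + offset G κ = s + 1 := by rw [hs]; push_cast; ring
    have hq : 0 ≤ 1 - 4 / s := by
      rw [sub_nonneg, div_le_one (by linarith)]; exact hs4
    rw [hss]
    rw [lintegral_comp_iterate hZ hind hid hstep h0 hx t
      (measurable_lyapunov (crossWeight G κ) T θs).ennreal_ofReal]
    calc ∫⁻ ω, ∫⁻ ω', ENNReal.ofReal (lyapunov (crossWeight G κ) T
          ((step t (Z 0 ω') (x t ω)).1 - θs) (step t (Z 0 ω') (x t ω)).2) ∂μ ∂μ
        ≤ ∫⁻ ω, (ENNReal.ofReal (1 - 4 / s) * ENNReal.ofReal (lyapunov (crossWeight G κ) T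
          ((x t ω).1 - θs) (x t ω).2) + ENNReal.ofReal (8 * offset G κ * σ ^ 2 / s ^ 2)) ∂μ := by
          refine lintegral_mono fun ω => ?_
          refine (ho.lintegral_lyapunov_le (hst t) (stepSize_pos hG hκ t)
            (stepSize_le_one hG hκ t) (stepSize_le hG hκ t) (x t ω) (hmem t ω)).trans ?_
          rw [stepSize_mul_rate hG hκ, stepSize_sq hG hκ, ← hs, ← ENNReal.ofReal_mul hq,
            ← ENNReal.ofReal_add (mul_nonneg hq (le_trans (by positivity)
              (le_lyapunov ho.norm_T_le hc0 hcG _ _))) (by positivity)]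
          exact ENNReal.ofReal_le_ofReal (le_of_eq (by ring))
      _ ≤ ENNReal.ofReal (1 - 4 / s) * ENNReal.ofReal (4 * D ^ 2 * offset G κ ^ 4 / s ^ 4 +
            8 * offset G κ * σ ^ 2 / s) + ENNReal.ofReal (8 * offset G κ * σ ^ 2 / s ^ 2) := by
          rw [lintegral_add_right _ measurable_const, lintegral_const_mul _
            (measurable_lyapunov_iterate hZ hstep h0 hx _ T θs t), lintegral_const, measure_univ, mul_one]
          gcongr
      _ ≤ _ := by
          rw [← ENNReal.ofReal_mul hq, ← ENNReal.ofReal_add (mul_nonneg hq (by positivity))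
            (by positivity)]
          exact ENNReal.ofReal_le_ofReal
            (recursion_bound_le hs4 (by positivity) (by positivity))

/-- The expected primal error of the iterates. -/
theorem integral_norm_iterate_sub_le (hZ : ∀ t, Measurable (Z t)) (hind : iIndepFun Z μ)
    (hid : ∀ t, IdentDistrib (Z t) (Z 0) μ μ)
    (hstep : ∀ t, Measurable fun p : 𝒵 × (Vec d × Vec d) => step t p.1 p.2)
    (h0 : ∀ ω, x 0 ω = x₀) (hx : ∀ t ω, x (t + 1) ω = step t (Z t ω) (x t ω))
    (ho : IsSaddleOracle μ (Z 0) T H κ G σ θs g h n)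
    (hst : ∀ t, IsPerturbedStep X G (stepSize G κ t) θs g h n (step t))
    (hx₀ : x₀.1 ∈ X) (hD : ‖x₀.1 - θs‖ ≤ D) (hD' : ‖x₀.2‖ ≤ D) (hσ : 0 ≤ σ) (t : ℕ) :
    Integrable (fun ω => ‖(x t ω).1 - θs‖) μ ∧
      ∫ ω, ‖(x t ω).1 - θs‖ ∂μ ≤ 3 * D * offset G κ ^ 2 * (1 / ((t : ℝ) + 1) ^ 2) +
        4 * offset G κ * σ * (1 / √((t : ℝ) + 1)) := by
  have hG := ho.one_le_G
  have hκ := ho.one_le_κ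
  have ht0 := four_le_offset hG hκ
  have hc0 := crossWeight_nonneg hG hκ
  have hcG := crossWeight_mul_le hG hκ
  have hD0 : 0 ≤ D := (norm_nonneg _).trans hD'
  set s : ℝ := t + offset G κ with hs
  have hs1 : (t : ℝ) + 1 ≤ s := by rw [hs]; linarith
  have ht1 : (0 : ℝ) < (t : ℝ) + 1 := by positivity
  set β : ℝ := 4 * D ^ 2 * offset G κ ^ 4 / s ^ 4 + 8 * offset G κ * σ ^ 2 / s with hβ
  have hbound : ∫⁻ ω, ENNReal.ofReal (‖(x t ω).1 - θs‖ ^ 2) ∂μ ≤ ENNReal.ofReal (2 * β) := by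
    calc ∫⁻ ω, ENNReal.ofReal (‖(x t ω).1 - θs‖ ^ 2) ∂μ
        ≤ ∫⁻ ω, ENNReal.ofReal 2 * ENNReal.ofReal (lyapunov (crossWeight G κ) T
          ((x t ω).1 - θs) (x t ω).2) ∂μ := by
          refine lintegral_mono fun ω => ?_
          rw [← ENNReal.ofReal_mul zero_le_two]
          refine ENNReal.ofReal_le_ofReal ?_
          have h1 := le_lyapunov ho.norm_T_le hc0 hcG ((x t ω).1 - θs) (x t ω).2
          have h2 := sq_nonneg ‖(x t ω).2‖
          linarith
      _ ≤ _ := by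
          rw [lintegral_const_mul _
            (measurable_lyapunov_iterate hZ hstep h0 hx _ T θs t), ENNReal.ofReal_mul zero_le_two]
          gcongr
          exact lintegral_lyapunov_iterate_le hZ hind hid hstep h0 hx ho hst hx₀ hD hD' t
  obtain ⟨hint, hle⟩ := integral_le_sqrt_of_lintegral_sq_le
    ((measurable_iterate hZ hstep h0 hx t).fst.sub_const θs).norm hbound
  -- The root of `2β` is bounded by a sum of roots: `8 ≤ 3²` for the initial error, and `16 * offset
  -- ≤ (4 * offset)²` for the noise.
  refine ⟨hint, hle.trans (Real.sqrt_le_iff.2 ⟨by positivity, ?_⟩)⟩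
  have hsq : √((t : ℝ) + 1) ^ 2 = t + 1 := Real.sq_sqrt ht1.le
  have h1 : 4 * D ^ 2 * offset G κ ^ 4 / s ^ 4 ≤ 4 * D ^ 2 * offset G κ ^ 4 / ((t : ℝ) + 1) ^ 4 := by
    gcongr
  have h2 : 8 * offset G κ * σ ^ 2 / s ≤ 8 * offset G κ * σ ^ 2 / ((t : ℝ) + 1) := by
    gcongr
  have h3 : (3 * D * offset G κ ^ 2 * (1 / ((t : ℝ) + 1) ^ 2)) ^ 2 =
      9 * (D ^ 2 * offset G κ ^ 4 / ((t : ℝ) + 1) ^ 4) := by field_simp; ring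
  have h4 : (4 * offset G κ * σ * (1 / √((t : ℝ) + 1))) ^ 2 =
      16 * (offset G κ ^ 2 * σ ^ 2 / ((t : ℝ) + 1)) := by
    rw [mul_pow, div_pow, hsq]; ring
  have h5 : offset G κ * σ ^ 2 / ((t : ℝ) + 1) ≤ offset G κ ^ 2 * σ ^ 2 / ((t : ℝ) + 1) := by
    gcongr; nlinarith
  have h6 : 0 ≤ D ^ 2 * offset G κ ^ 4 / ((t : ℝ) + 1) ^ 4 := by positivity
  have h7 : 0 ≤ (3 * D * offset G κ ^ 2 * (1 / ((t : ℝ) + 1) ^ 2)) *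
      (4 * offset G κ * σ * (1 / √((t : ℝ) + 1))) := by positivity
  have h8 : 4 * D ^ 2 * offset G κ ^ 4 / ((t : ℝ) + 1) ^ 4 =
      4 * (D ^ 2 * offset G κ ^ 4 / ((t : ℝ) + 1) ^ 4) := by ring
  have h9 : 8 * offset G κ * σ ^ 2 / ((t : ℝ) + 1) =
      8 * (offset G κ * σ ^ 2 / ((t : ℝ) + 1)) := by ring
  rw [add_sq, h3, h4]
  linarith

omit [IsProbabilityMeasure μ] in
/-- The expected error of the averaged iterates. -/
theorem integral_norm_average_sub_le {θ : ℕ → Ω → Vec d} {a b : ℝ} {θs : Vec d}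
    (hθ : ∀ t, Measurable (θ t)) (ha : 0 ≤ a) (hb : 0 ≤ b)
    (hint : ∀ t, Integrable (fun ω => ‖θ t ω - θs‖) μ)
    (hle : ∀ t : ℕ, ∫ ω, ‖θ t ω - θs‖ ∂μ ≤ a * (1 / ((t : ℝ) + 1) ^ 2) + b * (1 / √((t : ℝ) + 1)))
    {N : ℕ} (hN : 1 ≤ N) :
    Integrable (fun ω => ‖average (fun t => θ t ω) N - θs‖) μ ∧
      ∫ ω, ‖average (fun t => θ t ω) N - θs‖ ∂μ ≤ 2 * a / N + 2 * b / √N := by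
  have hN0 : (0 : ℝ) < N := by exact_mod_cast hN
  have hpt : ∀ ω, ‖average (fun t => θ t ω) N - θs‖ ≤
      1 / (N : ℝ) * ∑ t ∈ Finset.range N, ‖θ t ω - θs‖ := by
    intro ω
    have h1 : average (fun t => θ t ω) N - θs =
        (1 / (N : ℝ)) • ∑ t ∈ Finset.range N, (θ t ω - θs) := by
      rw [average, Finset.sum_sub_distrib, smul_sub, Finset.sum_const, Finset.card_range,
        ← Nat.cast_smul_eq_nsmul ℝ, smul_smul, one_div_mul_cancel hN0.ne', one_smul]
    rw [h1, norm_smul, Real.norm_of_nonneg (by positivity)]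
    gcongr
    exact norm_sum_le _ _
  have hsum : Integrable (fun ω => 1 / (N : ℝ) * ∑ t ∈ Finset.range N, ‖θ t ω - θs‖) μ :=
    (integrable_finsetSum _ fun t _ => hint t).const_mul _
  have hmeas : Measurable fun ω => ‖average (fun t => θ t ω) N - θs‖ := by
    have h1 : Measurable fun ω => ∑ t ∈ Finset.range N, θ t ω :=
      Finset.measurable_fun_sum _ fun t _ => hθ t
    have h2 : Measurable fun ω => average (fun t => θ t ω) N := h1.const_smul (1 / (N : ℝ))
    exact (h2.sub_const θs).norm
  have hi : Integrable (fun ω => ‖average (fun t => θ t ω) N - θs‖) μ :=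
    hsum.mono' hmeas.aestronglyMeasurable (Filter.Eventually.of_forall fun ω => by
      rw [norm_norm]; exact hpt ω)
  refine ⟨hi, (integral_mono hi hsum hpt).trans ?_⟩
  rw [integral_const_mul, integral_finsetSum _ fun t _ => hint t]
  have h1 : ∑ t ∈ Finset.range N, ∫ ω, ‖θ t ω - θs‖ ∂μ ≤ a * 2 + b * (2 * √N) := by
    refine (Finset.sum_le_sum fun t _ => hle t).trans ?_
    rw [Finset.sum_add_distrib, ← Finset.mul_sum, ← Finset.mul_sum]
    gcongr
    · exact sum_one_div_sq_le N
    · exact sum_one_div_sqrt_le N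
  have h2 : √(N : ℝ) ^ 2 = N := Real.sq_sqrt hN0.le
  have h3 : 0 < √(N : ℝ) := Real.sqrt_pos.2 hN0
  calc _ ≤ 1 / (N : ℝ) * (a * 2 + b * (2 * √N)) := by gcongr
    _ = 2 * a / N + 2 * b * (√N / N) := by ring
    _ = _ := by
      rw [Real.sqrt_div_self', mul_one_div]

end Iteration

end GradientTD

namespace GradientTD
namespace Model

/-! ### The three algorithms as instances -/

section Algorithms

variable {S : Type*} [Fintype S] [DecidableEq S] [MeasurableSpace S] [MeasurableSingletonClass S]
  {d : ℕ} {m : Model S d} {Ω : Type*} [MeasurableSpace Ω] {μ : Measure Ω} [IsProbabilityMeasure μ]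
  {Z : ℕ → Ω → Sample S} {B κ D σK : ℝ} {X Y : Set (Vec d)} {θ₁ y₁ θs : Vec d}

/-- A uniform bound on the features that is at least one. -/
noncomputable def featureBound (B : ℝ) : ℝ := max B 1

/-- The constant that bounds the multiplicative part of the oracles. -/
noncomputable def gain (B : ℝ) : ℝ := 6 * featureBound B ^ 4

theorem one_le_featureBound (B : ℝ) : 1 ≤ featureBound B := le_max_right _ _

theorem featureBound_sq_le (B : ℝ) : 6 * featureBound B ^ 2 ≤ gain B := by
  have := pow_le_pow_right₀ (one_le_featureBound B) (show 2 ≤ 4 by norm_num)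
  unfold gain; linarith

theorem one_le_gain (B : ℝ) : 1 ≤ gain B := by
  have := one_le_pow₀ (one_le_featureBound B) (n := 4)
  unfold gain; linarith

omit [DecidableEq S] [MeasurableSpace S] [MeasurableSingletonClass S] in
theorem norm_oracleK_sub_oracle_le {oracleF : Sample S → Vec d → Vec d} {b : ℝ} (hb : 1 ≤ b)
    (hφ : ∀ s, ‖m.φ s‖ ≤ b) (hF : ∀ z w, ‖oracleF z w‖ ≤ b ^ 2 * ‖w‖) (z : Sample S)
    (θ w : Vec d) : ‖m.oracleK z θ - oracleF z w‖ ≤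
      2 * b ^ 2 * (‖m.oracleK z θs‖ + ‖θ - θs‖ + ‖w‖) := by
  have h1 := norm_sub_le (m.oracleK z θ) (oracleF z w)
  have h2 := norm_oracleK_le hφ z θ θs
  have h3 := one_le_pow₀ hb (n := 2)
  nlinarith [hF z w, norm_nonneg (m.oracleK z θs), norm_nonneg w]

theorem isSaddleOracle (hst : m.Standing B κ D X Y θ₁ y₁) (hZ : m.IsIIDSample μ Z)
    (hθs : m.approxV θs = m.V) (hσ : ∫ ω, ‖m.oracleK (Z 0 ω) θs - m.K θs‖ ^ 2 ∂μ ≤ σK ^ 2)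
    {H : Vec d →L[ℝ] Vec d} {oracleF : Sample S → Vec d → Vec d}
    (hH : ∀ x, ‖H x‖ ≤ featureBound B ^ 2 * ‖x‖)
    (hHpos : ∀ x, ‖x‖ ^ 2 ≤ max κ 1 * ⟪x, H x⟫_ℝ)
    (hF : ∀ z w, ‖oracleF z w‖ ≤ featureBound B ^ 2 * ‖w‖)
    (hFint : ∀ x w, Integrable (fun ω => ⟪x, oracleF (Z 0 ω) w⟫_ℝ) μ)
    (hFmean : ∀ x w, ∫ ω, ⟪x, oracleF (Z 0 ω) w⟫_ℝ ∂μ = ⟪x, H w⟫_ℝ) :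
    IsSaddleOracle μ (Z 0) (matOp m.A) H (max κ 1) (gain B) σK θs m.coupling
      (fun z θ w => m.oracleK z θ - oracleF z w) (fun z => ‖m.oracleK z θs‖) := by
  have hb := one_le_featureBound B
  have hφ : ∀ s, ‖m.φ s‖ ≤ featureBound B := fun s => (hst.feature_le s).trans (le_max_left _ _)
  have hG := featureBound_sq_le B
  have hle : ∀ {c r : ℝ}, c ≤ 6 * featureBound B ^ 2 → 0 ≤ r → c * r ≤ gain B * r :=
    fun hc hr => mul_le_mul_of_nonneg_right (hc.trans hG) hr
  have hb2 := one_le_pow₀ hb (n := 2)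
  -- Since the mean oracle vanishes at `θs`, the variance bound there is a bound on the second
  -- moment of the additive noise.
  have hKs : m.K θs = 0 := by rw [K_eq m hθs, sub_self, map_zero, neg_zero]
  rw [hKs] at hσ
  simp only [sub_zero] at hσ
  refine
    { one_le_κ := le_max_right _ _
      one_le_G := one_le_gain B
      norm_T_le := fun x => (hZ.norm_A_le hφ x).trans (hle (by linarith) (norm_nonneg x))
      le_norm_T := fun x =>
        (norm_le_specNorm_inv_mul (m.A_injective hst.rank hst.rich) x).trans
          (mul_le_mul_of_nonneg_right (hst.invA_le.trans (le_max_left _ _)) (norm_nonneg _))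
      norm_H_le := fun x => (hH x).trans (hle (by linarith) (norm_nonneg x))
      le_inner_H := hHpos
      norm_g_le := fun z w => (norm_coupling_le hφ z w).trans (hle (by linarith) (norm_nonneg w))
      norm_h_le := fun z θ w => (norm_oracleK_sub_oracle_le hb hφ hF z θ w).trans
        (hle (by linarith) (by positivity))
      n_nonneg := fun z => norm_nonneg _
      integrable_g := hZ.integrable_inner_coupling
      integral_g := hZ.integral_inner_coupling
      integrable_h := fun x θ w => ?_
      integral_h := fun x θ w => ?_
      integrable_n := hZ.integrable_norm_oracleK_sq θs
      integral_n_le := hσ }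
  · simp only [inner_sub_right]
    exact (hZ.integrable_inner_oracleK x θ).sub (hFint x w)
  · simp only [inner_sub_right]
    rw [integral_sub (hZ.integrable_inner_oracleK x θ) (hFint x w), hZ.integral_inner_oracleK,
      hFmean, K_eq m hθs, inner_neg_right, inner_add_right]
    ring

/-! ### The updates as perturbed projected steps -/

variable (m) in
/-- One step of GTD or GTD2, where `oracleF` is the oracle for `∇F*`. -/
noncomputable def simpleStep (X : Set (Vec d)) (oracleF : Sample S → Vec d → Vec d) (a : ℝ)
    (z : Sample S) (x : Vec d × Vec d) : Vec d × Vec d :=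
  (prox X (a • 0) (x.1 + a • m.coupling z x.2), x.2 + a • (m.oracleK z x.1 - oracleF z x.2))

variable (m) in
/-- One step of GTD2-MP. -/
noncomputable def extraStep (X : Set (Vec d)) (a : ℝ) (z : Sample S) (x : Vec d × Vec d) :
    Vec d × Vec d :=
  (prox X (a • 0) (x.1 + a • m.coupling z (m.simpleStep X m.oracleFgtd2 a z x).2),
    x.2 + a • (m.oracleK z (m.simpleStep X m.oracleFgtd2 a z x).1 -
      m.oracleFgtd2 z (m.simpleStep X m.oracleFgtd2 a z x).2))

omit [DecidableEq S] in
theorem measurable_φ : Measurable m.φ := Measurable.of_discrete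

omit [DecidableEq S] in
theorem measurable_coupling {α : Type*} [MeasurableSpace α] {z : α → Sample S} {w : α → Vec d}
    (hz : Measurable z) (hw : Measurable w) : Measurable fun p => m.coupling (z p) (w p) := by
  have h1 : Measurable fun p => m.φ (z p).1 := measurable_φ.comp hz.fst
  have h2 : Measurable fun p => m.φ (z p).2.2 := measurable_φ.comp hz.snd.snd
  exact (h1.inner (𝕜 := ℝ) hw).smul (h1.sub (h2.const_smul m.γ))

omit [DecidableEq S] in
theorem measurable_oracleFgtd2 {α : Type*} [MeasurableSpace α] {z : α → Sample S} {w : α → Vec d}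
    (hz : Measurable z) (hw : Measurable w) : Measurable fun p => m.oracleFgtd2 (z p) (w p) := by
  have h1 : Measurable fun p => m.φ (z p).1 := measurable_φ.comp hz.fst
  exact (h1.inner (𝕜 := ℝ) hw).smul h1

omit [DecidableEq S] in
theorem measurable_oracleK {α : Type*} [MeasurableSpace α] {z : α → Sample S} {θ : α → Vec d}
    (hz : Measurable z) (hθ : Measurable θ) : Measurable fun p => m.oracleK (z p) (θ p) := by
  have h1 : Measurable fun p => m.φ (z p).1 := measurable_φ.comp hz.fst
  have h2 : Measurable fun p => m.φ (z p).2.2 := measurable_φ.comp hz.snd.snd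
  exact ((hz.snd.fst.add ((h2.inner (𝕜 := ℝ) hθ).const_mul m.γ)).sub (h1.inner (𝕜 := ℝ) hθ)).smul h1

omit [DecidableEq S] in
theorem measurable_simpleStep (hc : IsClosed X) (hX : Convex ℝ X) (hne : X.Nonempty)
    {oracleF : Sample S → Vec d → Vec d}
    (hF : Measurable fun p : Sample S × (Vec d × Vec d) => oracleF p.1 p.2.2) (a : ℝ) :
    Measurable fun p : Sample S × (Vec d × Vec d) => m.simpleStep X oracleF a p.1 p.2 := by
  have h1 : Measurable fun p : Sample S × (Vec d × Vec d) => m.coupling p.1 p.2.2 :=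
    measurable_coupling measurable_fst measurable_snd.snd
  have h2 : Measurable fun p : Sample S × (Vec d × Vec d) => m.oracleK p.1 p.2.1 :=
    measurable_oracleK measurable_fst measurable_snd.fst
  exact ((measurable_prox_zero hc hX hne a).comp
    (measurable_snd.fst.add (h1.const_smul a))).prodMk
    (measurable_snd.snd.add ((h2.sub hF).const_smul a))

omit [DecidableEq S] in
theorem measurable_extraStep (hc : IsClosed X) (hX : Convex ℝ X) (hne : X.Nonempty) (a : ℝ) :
    Measurable fun p : Sample S × (Vec d × Vec d) => m.extraStep X a p.1 p.2 := by
  have h0 := measurable_simpleStep (m := m) hc hX hne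
    (measurable_oracleFgtd2 (m := m) measurable_fst measurable_snd.snd) a
  have h1 := measurable_coupling (m := m) measurable_fst h0.snd
  have h2 := measurable_oracleK (m := m) measurable_fst h0.fst
  have h3 := measurable_oracleFgtd2 (m := m) measurable_fst h0.snd
  exact ((measurable_prox_zero hc hX hne a).comp
    (measurable_snd.fst.add (h1.const_smul a))).prodMk
    (measurable_snd.snd.add ((h2.sub h3).const_smul a))

omit [MeasurableSpace S] [MeasurableSingletonClass S] [DecidableEq S] in
theorem norm_prox_zero_add_sub_le (hc : IsClosed X) (hX : Convex ℝ X) (hθs : θs ∈ X) {a : ℝ}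
    (ha : 0 ≤ a) {x : Vec d} (hx : x ∈ X) (u : Vec d) :
    ‖prox X (a • 0) (x + a • u) - θs‖ ≤ ‖x - θs + a • u‖ ∧
      ‖prox X (a • 0) (x + a • u) - x‖ ≤ a * ‖u‖ := by
  constructor
  · refine (norm_prox_zero_sub_le_of_mem hc hX a hθs _).trans (le_of_eq ?_)
    congr 1; abel
  · refine (norm_prox_zero_sub_le_of_mem hc hX a hx _).trans (le_of_eq ?_)
    rw [add_sub_cancel_left, norm_smul, Real.norm_of_nonneg ha]

-- Here the step follows the oracles exactly, so both perturbations are zero.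
omit [MeasurableSpace S] [MeasurableSingletonClass S] [DecidableEq S] in
theorem isPerturbedStep_simpleStep (hc : IsClosed X) (hX : Convex ℝ X) (hθs : θs ∈ X)
    (oracleF : Sample S → Vec d → Vec d) {G a : ℝ} (hG : 0 ≤ G) (ha : 0 ≤ a) :
    IsPerturbedStep X G a θs m.coupling (fun z θ w => m.oracleK z θ - oracleF z w)
      (fun z => ‖m.oracleK z θs‖) (m.simpleStep X oracleF a) where
  mem z x := prox_zero_mem hc hX ⟨θs, hθs⟩ a _
  dual z x _ := by
    rw [simpleStep, sub_self, norm_zero]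
    positivity
  primal z x hx := by
    refine ⟨m.coupling z x.2, ?_, norm_prox_zero_add_sub_le hc hX hθs ha hx _⟩
    rw [sub_self, norm_zero]
    positivity

omit [MeasurableSpace S] [MeasurableSingletonClass S] [DecidableEq S] in
theorem oracleFgtd2_sub (z : Sample S) (w w' : Vec d) :
    m.oracleFgtd2 z w - m.oracleFgtd2 z w' = m.oracleFgtd2 z (w - w') := by
  simp only [oracleFgtd2, inner_sub_right, sub_smul]

omit [MeasurableSpace S] [MeasurableSingletonClass S] [DecidableEq S] in
theorem coupling_sub (z : Sample S) (w w' : Vec d) :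
    m.coupling z w - m.coupling z w' = m.coupling z (w - w') := by
  simp only [coupling, inner_sub_right, sub_smul]

-- The half step moves each variable by at most `a * 2b² q`, and the oracles are Lipschitz with
-- constants `2b²` and `b²`. The directions therefore change by at most `4b⁴ a q` for `θ` and `6b⁴ a
-- q` for `w`, which is the source of `gain B = 6b⁴`. The estimate is pathwise, so sharing one
-- sample between the half steps causes no bias problem.
omit [MeasurableSpace S] [MeasurableSingletonClass S] [DecidableEq S] in
theorem isPerturbedStep_extraStep (hc : IsClosed X) (hX : Convex ℝ X) (hθs : θs ∈ X)
    (hφ : ∀ s, ‖m.φ s‖ ≤ B) {a : ℝ} (ha : 0 ≤ a) :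
    IsPerturbedStep X (gain B) a θs m.coupling (fun z θ w => m.oracleK z θ - m.oracleFgtd2 z w)
      (fun z => ‖m.oracleK z θs‖) (m.extraStep X a) := by
  have hb := one_le_featureBound B
  replace hφ : ∀ s, ‖m.φ s‖ ≤ featureBound B := fun s => (hφ s).trans (le_max_left _ _)
  set b := featureBound B with hbdef
  have hG : gain B = 6 * b ^ 4 := rfl
  have hb2 := one_le_pow₀ hb (n := 2)
  have hw : ∀ z x, ‖(m.simpleStep X m.oracleFgtd2 a z x).2 - x.2‖ ≤
      a * (2 * b ^ 2 * (‖m.oracleK z θs‖ + ‖x.1 - θs‖ + ‖x.2‖)) := fun z x => by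
    rw [simpleStep, add_sub_cancel_left, norm_smul, Real.norm_of_nonneg ha]
    gcongr
    exact norm_oracleK_sub_oracle_le hb hφ (norm_oracleFgtd2_le hφ) z x.1 x.2
  refine ⟨fun z x => prox_zero_mem hc hX ⟨θs, hθs⟩ a _, fun z x hx => ?_, fun z x hx =>
    ⟨m.coupling z (m.simpleStep X m.oracleFgtd2 a z x).2, ?_,
      norm_prox_zero_add_sub_le hc hX hθs ha hx _⟩⟩
  · set θ' := (m.simpleStep X m.oracleFgtd2 a z x).1
    set w' := (m.simpleStep X m.oracleFgtd2 a z x).2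
    set q := ‖m.oracleK z θs‖ + ‖x.1 - θs‖ + ‖x.2‖ with hq
    have hwq : ‖x.2‖ ≤ q := by
      have : 0 ≤ ‖m.oracleK z θs‖ + ‖x.1 - θs‖ := by positivity
      linarith
    have hθ : ‖θ' - x.1‖ ≤ a * (2 * b ^ 2 * q) := by
      refine (norm_prox_zero_add_sub_le hc hX hθs ha hx _).2.trans ?_
      gcongr
      exact (norm_coupling_le hφ z x.2).trans (by gcongr)
    have heq : (m.extraStep X a z x).2 - (x.2 + a • (m.oracleK z x.1 - m.oracleFgtd2 z x.2)) =
        a • ((m.oracleK z θ' - m.oracleK z x.1) - m.oracleFgtd2 z (w' - x.2)) := by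
      rw [← oracleFgtd2_sub, extraStep]
      module
    rw [heq, norm_smul, Real.norm_of_nonneg ha]
    calc a * ‖(m.oracleK z θ' - m.oracleK z x.1) - m.oracleFgtd2 z (w' - x.2)‖
        ≤ a * (2 * b ^ 2 * (a * (2 * b ^ 2 * q)) + b ^ 2 * (a * (2 * b ^ 2 * q))) := by
          gcongr
          refine (norm_sub_le _ _).trans (add_le_add ?_ ?_)
          · exact (norm_oracleK_sub_le hφ z _ _).trans (by gcongr)
          · exact (norm_oracleFgtd2_le hφ z _).trans (by gcongr; exact hw z x)
      _ = a ^ 2 * (gain B * q) := by rw [hG]; ring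
  · rw [coupling_sub]
    refine (norm_coupling_le hφ _ _).trans ?_
    set q := ‖m.oracleK z θs‖ + ‖x.1 - θs‖ + ‖x.2‖
    have hq : 0 ≤ q := by positivity
    calc 2 * b ^ 2 * ‖(m.simpleStep X m.oracleFgtd2 a z x).2 - x.2‖
        ≤ 2 * b ^ 2 * (a * (2 * b ^ 2 * q)) := by gcongr; exact hw z x
      _ = a * (4 * b ^ 4 * q) := by ring
      _ ≤ a * (gain B * q) := by rw [hG]; gcongr; norm_num


/-! ### Bounds on the value error -/

/-- The step size, as a function of the bounds on the features and on the inverse matrices. -/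
noncomputable def tdStepSize (B κ : ℝ) : ℕ → ℝ := stepSize (gain B) (max κ 1)

/-- The constant of the error bounds. -/
noncomputable def errorConst (B κ D : ℝ) : ℝ :=
  featureBound B ^ 2 * (6 * D * offset (gain B) (max κ 1) ^ 2 + 8 * offset (gain B) (max κ 1))

theorem tdStepSize_pos (B κ : ℝ) (t : ℕ) : 0 < tdStepSize B κ t :=
  stepSize_pos (one_le_gain B) (le_max_right κ 1) t

theorem errorConst_nonneg (B κ : ℝ) (hD : 0 ≤ D) : 0 ≤ errorConst B κ D := by
  have := four_le_offset (one_le_gain B) (le_max_right κ 1)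
  unfold errorConst; positivity

theorem integral_value_error_le (hst : m.Standing B κ D X Y θ₁ y₁) (hZ : m.IsIIDSample μ Z)
    (hθs : m.approxV θs = m.V) (hθD : ‖θ₁ - θs‖ ≤ D) (hσ0 : 0 ≤ σK)
    (hσ : ∫ ω, ‖m.oracleK (Z 0 ω) θs - m.K θs‖ ^ 2 ∂μ ≤ σK ^ 2)
    {H : Vec d →L[ℝ] Vec d} {oracleF : Sample S → Vec d → Vec d}
    (hH : ∀ x, ‖H x‖ ≤ featureBound B ^ 2 * ‖x‖)
    (hHpos : ∀ x, ‖x‖ ^ 2 ≤ max κ 1 * ⟪x, H x⟫_ℝ)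
    (hF : ∀ z w, ‖oracleF z w‖ ≤ featureBound B ^ 2 * ‖w‖)
    (hFint : ∀ x w, Integrable (fun ω => ⟪x, oracleF (Z 0 ω) w⟫_ℝ) μ)
    (hFmean : ∀ x w, ∫ ω, ⟪x, oracleF (Z 0 ω) w⟫_ℝ ∂μ = ⟪x, H w⟫_ℝ)
    {step : ℕ → Sample S → Vec d × Vec d → Vec d × Vec d}
    (hstep : ∀ t, Measurable fun p : Sample S × (Vec d × Vec d) => step t p.1 p.2)
    (hpert : ∀ t, IsPerturbedStep X (gain B) (tdStepSize B κ t) θs m.coupling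
      (fun z θ w => m.oracleK z θ - oracleF z w) (fun z => ‖m.oracleK z θs‖) (step t))
    {x : ℕ → Ω → Vec d × Vec d} (h0 : ∀ ω, x 0 ω = (θ₁, y₁))
    (hx : ∀ t ω, x (t + 1) ω = step t (Z t ω) (x t ω)) {N : ℕ} (hN : 1 ≤ N) :
    Integrable (fun ω => ‖m.V - m.approxV (average (fun t => (x t ω).1) N)‖) μ ∧
      ∫ ω, ‖m.V - m.approxV (average (fun t => (x t ω).1) N)‖ ∂μ ≤
        m.Lφ * (errorConst B κ D * (1 / N + σK / √N)) := by
  have hφ : ∀ s, ‖m.φ s‖ ≤ featureBound B := fun s => (hst.feature_le s).trans (le_max_left _ _)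
  have hD : 0 ≤ D := (norm_nonneg _).trans hst.y₁_le
  have hoff := four_le_offset (one_le_gain B) (le_max_right κ 1)
  have ho := isSaddleOracle hst hZ hθs hσ hH hHpos hF hFint hFmean
  have hiter := integral_norm_iterate_sub_le hZ.measurable hZ.indep hZ.ident hstep h0 hx ho hpert
    hst.θ₁_mem hθD hst.y₁_le hσ0
  have hmeas := fun t => (measurable_iterate hZ.measurable hstep h0 hx t).fst
  obtain ⟨hi, hle⟩ := integral_norm_average_sub_le (θ := fun t ω => (x t ω).1) hmeas
    (a := 3 * D * offset (gain B) (max κ 1) ^ 2) (b := 4 * offset (gain B) (max κ 1) * σK)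
    (by positivity) (by positivity) (fun t => (hiter t).1) (fun t => (hiter t).2) hN
  set avg : Ω → Vec d := fun ω => average (fun t => (x t ω).1) N with havg
  have hpt : ∀ ω, ‖m.V - m.approxV (avg ω)‖ ≤
      m.Lφ * featureBound B ^ 2 * ‖avg ω - θs‖ := by
    intro ω
    have h1 : m.V - m.approxV (avg ω) = m.approxV (θs - avg ω) := by
      simp only [← hθs, approxV, WithLp.ofLp_sub, Matrix.mulVec_sub]
    rw [h1, norm_sub_rev, mul_assoc]
    refine (m.norm_approxV_le hst.rank _).trans ?_
    exact mul_le_mul_of_nonneg_left (hZ.norm_M_le hφ _) m.Lφ_nonneg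
  have hmavg : Measurable avg := by
    have h1 : Measurable fun ω => ∑ t ∈ Finset.range N, (x t ω).1 :=
      Finset.measurable_fun_sum _ fun t _ => hmeas t
    exact h1.const_smul (1 / (N : ℝ))
  have hcont : Continuous m.approxV := by
    unfold approxV
    fun_prop
  have hdom := hi.const_mul (m.Lφ * featureBound B ^ 2)
  have hint : Integrable (fun ω => ‖m.V - m.approxV (avg ω)‖) μ :=
    hdom.mono' (((hcont.measurable.comp hmavg).const_sub m.V).norm).aestronglyMeasurable
      (Filter.Eventually.of_forall fun ω => by rw [norm_norm]; exact hpt ω)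
  refine ⟨hint, (integral_mono hint hdom hpt).trans ?_⟩
  rw [integral_const_mul]
  have hL := m.Lφ_nonneg
  have hN0 : (0 : ℝ) < N := by exact_mod_cast hN
  calc m.Lφ * featureBound B ^ 2 * ∫ ω, ‖avg ω - θs‖ ∂μ
      ≤ m.Lφ * featureBound B ^ 2 * (2 * (3 * D * offset (gain B) (max κ 1) ^ 2) / N +
        2 * (4 * offset (gain B) (max κ 1) * σK) / √N) := by gcongr
    _ = m.Lφ * (featureBound B ^ 2 * (6 * D * offset (gain B) (max κ 1) ^ 2 * (1 / N) +
        8 * offset (gain B) (max κ 1) * (σK / √N))) := by ring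
    _ ≤ _ := by
      unfold errorConst
      have h1 : 0 ≤ 6 * D * offset (gain B) (max κ 1) ^ 2 := by positivity
      have h2 : 0 ≤ 8 * offset (gain B) (max κ 1) := by positivity
      have h3 : 0 ≤ 1 / (N : ℝ) := by positivity
      have h4 : 0 ≤ σK / √N := by positivity
      -- The two constants are merged by `p x + q y ≤ (p + q)(x + y)` for nonnegative terms.
      rw [mul_assoc (featureBound B ^ 2)]
      refine mul_le_mul_of_nonneg_left (mul_le_mul_of_nonneg_left ?_ (by positivity)) hL
      linarith [mul_nonneg h1 h4, mul_nonneg h2 h3]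

omit [DecidableEq S] [MeasurableSpace S] [MeasurableSingletonClass S] in
theorem gtd_succ (X : Set (Vec d)) (α : ℕ → ℝ) (θ₁ y₁ : Vec d) (z : ℕ → Sample S) (t : ℕ) :
    m.gtd X 0 α θ₁ y₁ z (t + 1) =
      m.simpleStep X m.oracleFgtd (α t) (z t) (m.gtd X 0 α θ₁ y₁ z t) := by
  rw [gtd, simpleStep, coupling, real_inner_comm]
  rfl

omit [DecidableEq S] [MeasurableSpace S] [MeasurableSingletonClass S] in
theorem gtd2_succ (X : Set (Vec d)) (α : ℕ → ℝ) (θ₁ w₁ : Vec d) (z : ℕ → Sample S) (t : ℕ) :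
    m.gtd2 X 0 α θ₁ w₁ z (t + 1) =
      m.simpleStep X m.oracleFgtd2 (α t) (z t) (m.gtd2 X 0 α θ₁ w₁ z t) := by
  rw [gtd2, simpleStep, coupling, oracleK, oracleFgtd2, ← sub_smul, real_inner_comm]

omit [DecidableEq S] [MeasurableSpace S] [MeasurableSingletonClass S] in
theorem gtd2mp_succ (X : Set (Vec d)) (α : ℕ → ℝ) (θ₁ w₁ : Vec d) (z : ℕ → Sample S) (t : ℕ) :
    m.gtd2mp X 0 α α θ₁ w₁ z (t + 1) =
      m.extraStep X (α t) (z t) (m.gtd2mp X 0 α α θ₁ w₁ z t) := by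
  rw [gtd2mp]
  simp only [extraStep, simpleStep, coupling, oracleK, oracleFgtd2, ← sub_smul]

theorem integral_gtd2_oracle_error_le (hst : m.Standing B κ D X Y θ₁ y₁) (hZ : m.IsIIDSample μ Z)
    (hθs : m.approxV θs = m.V) (hθD : ‖θ₁ - θs‖ ≤ D) (hσ0 : 0 ≤ σK)
    (hσ : ∫ ω, ‖m.oracleK (Z 0 ω) θs - m.K θs‖ ^ 2 ∂μ ≤ σK ^ 2)
    {step : ℕ → Sample S → Vec d × Vec d → Vec d × Vec d}
    (hstep : ∀ t, Measurable fun p : Sample S × (Vec d × Vec d) => step t p.1 p.2)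
    (hpert : ∀ t, IsPerturbedStep X (gain B) (tdStepSize B κ t) θs m.coupling
      (fun z θ w => m.oracleK z θ - m.oracleFgtd2 z w) (fun z => ‖m.oracleK z θs‖) (step t))
    {x : ℕ → Ω → Vec d × Vec d} (h0 : ∀ ω, x 0 ω = (θ₁, y₁))
    (hx : ∀ t ω, x (t + 1) ω = step t (Z t ω) (x t ω)) {N : ℕ} (hN : 1 ≤ N) :
    Integrable (fun ω => ‖m.V - m.approxV (average (fun t => (x t ω).1) N)‖) μ ∧
      ∫ ω, ‖m.V - m.approxV (average (fun t => (x t ω).1) N)‖ ∂μ ≤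
        m.Lφ * (errorConst B κ D * (1 / N + σK / √N)) := by
  have hφ : ∀ s, ‖m.φ s‖ ≤ featureBound B := fun s => (hst.feature_le s).trans (le_max_left _ _)
  exact integral_value_error_le hst hZ hθs hθD hσ0 hσ (H := matOp m.M) (hZ.norm_M_le hφ)
    (m.norm_sq_le_inner_M hst.rank (by positivity) (hst.invM_le.trans (le_max_left _ _)))
    (norm_oracleFgtd2_le hφ) hZ.integrable_inner_oracleFgtd2 hZ.integral_inner_oracleFgtd2
    hstep hpert h0 hx hN

omit [MeasurableSpace S] [MeasurableSingletonClass S] in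
/-- Any bound in terms of `1` extends to a bound in terms of `L_{F*} = ‖M‖`; for `d = 0` both sides
vanish. -/
theorem Lφ_mul_le (hst : m.Standing B κ D X Y θ₁ y₁) {c a b p q : ℝ} (hc : 0 ≤ c) (ha : 0 ≤ a)
    (hp : 0 ≤ p) (hq : 0 ≤ q) (hbq : b ≤ q) :
    m.Lφ * (c * (a + b)) ≤
      m.Lφ / (1 - m.γ) * (c * max κ 1 * ((m.LFgtd2 + p) * a + q)) := by
  have hL := m.Lφ_nonneg
  have hγ : 0 < 1 - m.γ := sub_pos.2 m.γ_lt_one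
  have hγ1 : 1 - m.γ ≤ 1 := by linarith [m.γ_nonneg]
  -- For `d = 0` the norm of `M` is `0` and cannot dominate `1`, but then `L_φ` is an empty sum and
  -- vanishes too.
  rcases Nat.eq_zero_or_pos d with rfl | hd
  · have : m.Lφ = 0 := by simp [Lφ]
    simp [this]
  · have h1 : 1 ≤ max κ 1 * m.LFgtd2 := m.one_le_mul_specNorm_M hst.rank hd (by positivity)
      (hst.invM_le.trans (le_max_left _ _))
    have h2 : a ≤ max κ 1 * m.LFgtd2 * a := le_mul_of_one_le_left ha h1
    have h3 : q ≤ max κ 1 * q := le_mul_of_one_le_left hq (le_max_right _ _)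
    have h4 : 0 ≤ max κ 1 * p * a := by positivity
    calc m.Lφ * (c * (a + b)) ≤ m.Lφ * (c * max κ 1 * ((m.LFgtd2 + p) * a + q)) := by
          rw [mul_assoc c]
          gcongr
          linarith
      _ ≤ _ := by
          have h5 : 0 ≤ m.LFgtd2 := norm_nonneg _
          gcongr
          exact le_div_self hL hγ hγ1

theorem le_totalNoise {σF σK σy : ℝ} (hy : 0 ≤ σy) : σK ≤ totalNoise σF σK σy := by
  have : σK ≤ √(σF ^ 2 + σK ^ 2) := Real.le_sqrt_of_sq_le (by linarith [sq_nonneg σF])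
  unfold totalNoise
  linarith

theorem sqrt_natCast_le_self {N : ℕ} (hN : 1 ≤ N) : √(N : ℝ) ≤ N :=
  Real.sqrt_le_self_iff.2 (Or.inr (by exact_mod_cast hN))

theorem one_div_natCast_le {N : ℕ} (hN : 1 ≤ N) : 1 / (N : ℝ) ≤ 1 / √N :=
  one_div_le_one_div_of_le (Real.sqrt_pos.2 (by exact_mod_cast hN)) (sqrt_natCast_le_self hN)

end Algorithms

end Model
end GradientTD

/-! ### Assembly of the three bounds -/

open GradientTD GradientTD.Model in
theorem proposition3 (B κ D : ℝ) :
    -- GTD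
    (∃ (α : ℕ → ℝ) (C : ℝ), (∀ t, 0 < α t) ∧
      ∀ (S : Type*) [Fintype S] [DecidableEq S] [MeasurableSpace S] [MeasurableSingletonClass S]
        (d : ℕ) (m : GradientTD.Model S d) (X Y : Set (GradientTD.Vec d))
        (θ₁ y₁ : GradientTD.Vec d)
        (Ω : Type*) [MeasurableSpace Ω] (μ : Measure Ω) [IsProbabilityMeasure μ]
        (Z : ℕ → Ω → GradientTD.Sample S) (σF σK σy : ℝ),
        m.Standing B κ D X Y θ₁ y₁ → m.IsIIDSample μ Z →
        m.NoiseBound μ (Z 0) m.oracleFgtd m.gradFgtd X Y σF σK σy →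
        ∀ N : ℕ, 1 ≤ N →
          let err : Ω → ℝ := fun ω => ‖m.V - m.approxV
            (GradientTD.average (fun t => (m.gtd X 0 α θ₁ y₁ (fun i => Z i ω) t).1) N)‖
          Integrable err μ ∧
          ∫ ω, err ω ∂μ ≤ m.Lφ / (1 - m.γ) *
            (C * ((m.LFgtd + m.LK + GradientTD.totalNoise σF σK σy) / √(N : ℝ)))) ∧
    -- GTD2
    (∃ (α : ℕ → ℝ) (C : ℝ), (∀ t, 0 < α t) ∧
      ∀ (S : Type*) [Fintype S] [DecidableEq S] [MeasurableSpace S] [MeasurableSingletonClass S]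
        (d : ℕ) (m : GradientTD.Model S d) (X Y : Set (GradientTD.Vec d))
        (θ₁ w₁ : GradientTD.Vec d)
        (Ω : Type*) [MeasurableSpace Ω] (μ : Measure Ω) [IsProbabilityMeasure μ]
        (Z : ℕ → Ω → GradientTD.Sample S) (σF σK σy : ℝ),
        m.Standing B κ D X Y θ₁ w₁ → m.IsIIDSample μ Z →
        m.NoiseBound μ (Z 0) m.oracleFgtd2 m.gradFgtd2 X Y σF σK σy →
        ∀ N : ℕ, 1 ≤ N →
          let err : Ω → ℝ := fun ω => ‖m.V - m.approxV
            (GradientTD.average (fun t => (m.gtd2 X 0 α θ₁ w₁ (fun i => Z i ω) t).1) N)‖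
          Integrable err μ ∧
          ∫ ω, err ω ∂μ ≤ m.Lφ / (1 - m.γ) *
            (C * ((m.LFgtd2 + m.LK + GradientTD.totalNoise σF σK σy) / √(N : ℝ)))) ∧
    -- GTD2-MP
    (∃ (α β : ℕ → ℝ) (C : ℝ), (∀ t, 0 < α t) ∧ (∀ t, 0 < β t) ∧
      ∀ (S : Type*) [Fintype S] [DecidableEq S] [MeasurableSpace S] [MeasurableSingletonClass S]
        (d : ℕ) (m : GradientTD.Model S d) (X Y : Set (GradientTD.Vec d))
        (θ₁ w₁ : GradientTD.Vec d)
        (Ω : Type*) [MeasurableSpace Ω] (μ : Measure Ω) [IsProbabilityMeasure μ]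
        (Z : ℕ → Ω → GradientTD.Sample S) (σF σK σy : ℝ),
        m.Standing B κ D X Y θ₁ w₁ → m.IsIIDSample μ Z →
        m.NoiseBound μ (Z 0) m.oracleFgtd2 m.gradFgtd2 X Y σF σK σy →
        ∀ N : ℕ, 1 ≤ N →
          let err : Ω → ℝ := fun ω => ‖m.V - m.approxV
            (GradientTD.average (fun t => (m.gtd2mp X 0 α β θ₁ w₁ (fun i => Z i ω) t).1) N)‖
          Integrable err μ ∧
          ∫ ω, err ω ∂μ ≤ m.Lφ / (1 - m.γ) *
            (C * ((m.LFgtd2 + m.LK) / (N : ℝ) + GradientTD.totalNoise σF σK σy / √(N : ℝ)))) := by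
  -- One step-size sequence serves all three algorithms, with equal primal and dual steps for
  -- GTD2-MP. The extra factor `max κ 1` pays for replacing `1` by `‖M‖`; for GTD `L_{F*} = 1`
  -- already.
  refine ⟨⟨tdStepSize B κ, errorConst B κ D, tdStepSize_pos B κ, ?_⟩,
    ⟨tdStepSize B κ, errorConst B κ D * max κ 1, tdStepSize_pos B κ, ?_⟩,
    ⟨tdStepSize B κ, tdStepSize B κ, errorConst B κ D * max κ 1, tdStepSize_pos B κ,
      tdStepSize_pos B κ, ?_⟩⟩
  · intro S _ _ _ _ d m X Y θ₁ y₁ Ω _ μ _ Z σF σK σy hst hZ hnoise N hN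
    obtain ⟨θs, hθsX, hθs, hθD⟩ := hst.saddle
    have hb := one_le_pow₀ (one_le_featureBound B) (n := 2)
    obtain ⟨hi, hle⟩ := integral_value_error_le hst hZ hθs hθD hnoise.σK_nonneg
      (hnoise.boundK θs hθsX) (H := ContinuousLinearMap.id ℝ _) (oracleF := m.oracleFgtd)
      (fun x => le_mul_of_one_le_left (norm_nonneg x) hb)
      (fun x => by
        rw [ContinuousLinearMap.id_apply, real_inner_self_eq_norm_sq]
        exact le_mul_of_one_le_left (sq_nonneg _) (le_max_right _ _))
      (fun _ w => le_mul_of_one_le_left (norm_nonneg w) hb)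
      (fun x w => integrable_const (⟪x, w⟫_ℝ)) (fun x w => by simp [oracleFgtd])
      (fun t => measurable_simpleStep hst.X_closed hst.X_convex ⟨θs, hθsX⟩
        measurable_snd.snd (tdStepSize B κ t))
      (fun t => isPerturbedStep_simpleStep hst.X_closed hst.X_convex hθsX m.oracleFgtd
        (zero_le_one.trans (one_le_gain B)) (tdStepSize_pos B κ t).le)
      (x := fun t ω => m.gtd X 0 (tdStepSize B κ) θ₁ y₁ (fun i => Z i ω) t)
      (fun ω => rfl) (fun t ω => gtd_succ X _ θ₁ y₁ _ t) hN
    refine ⟨hi, hle.trans ?_⟩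
    have hD : 0 ≤ D := (norm_nonneg _).trans hst.y₁_le
    have hC := errorConst_nonneg B κ hD
    have hL := m.Lφ_nonneg
    have hγ : 0 < 1 - m.γ := sub_pos.2 m.γ_lt_one
    have hσ := le_totalNoise (σF := σF) (σK := σK) hnoise.σy_nonneg
    have hσ0 := hnoise.σK_nonneg.trans hσ
    have hLK : 0 ≤ m.LK := sq_nonneg _
    have h1 : 1 / (N : ℝ) + σK / √N ≤ (m.LFgtd + m.LK + totalNoise σF σK σy) / √N := by
      have h2 : 1 / √(N : ℝ) + σK / √N ≤ (m.LFgtd + m.LK + totalNoise σF σK σy) / √N := by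
        rw [← add_div]
        gcongr
        rw [LFgtd]
        linarith
      linarith [one_div_natCast_le hN]
    calc m.Lφ * (errorConst B κ D * (1 / N + σK / √N)) ≤
          m.Lφ * (errorConst B κ D * ((m.LFgtd + m.LK + totalNoise σF σK σy) / √N)) := by gcongr
      _ ≤ _ := by
        have h3 : 0 ≤ m.LFgtd := zero_le_one
        gcongr
        exact le_div_self hL hγ (by linarith [m.γ_nonneg])
  · intro S _ _ _ _ d m X Y θ₁ w₁ Ω _ μ _ Z σF σK σy hst hZ hnoise N hN
    obtain ⟨θs, hθsX, hθs, hθD⟩ := hst.saddle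
    obtain ⟨hi, hle⟩ := integral_gtd2_oracle_error_le hst hZ hθs hθD hnoise.σK_nonneg
      (hnoise.boundK θs hθsX)
      (fun t => measurable_simpleStep hst.X_closed hst.X_convex ⟨θs, hθsX⟩
        (measurable_oracleFgtd2 measurable_fst measurable_snd.snd) (tdStepSize B κ t))
      (fun t => isPerturbedStep_simpleStep hst.X_closed hst.X_convex hθsX m.oracleFgtd2
        (zero_le_one.trans (one_le_gain B)) (tdStepSize_pos B κ t).le)
      (x := fun t ω => m.gtd2 X 0 (tdStepSize B κ) θ₁ w₁ (fun i => Z i ω) t)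
      (fun ω => rfl) (fun t ω => gtd2_succ X _ θ₁ w₁ _ t) hN
    refine ⟨hi, hle.trans ?_⟩
    have hD : 0 ≤ D := (norm_nonneg _).trans hst.y₁_le
    have hC := errorConst_nonneg B κ hD
    have hL := m.Lφ_nonneg
    have hσ := le_totalNoise (σF := σF) (σK := σK) hnoise.σy_nonneg
    have hσK := hnoise.σK_nonneg
    -- Relaxing `1/N` to `1/√N` lets all terms share one denominator.
    calc m.Lφ * (errorConst B κ D * (1 / N + σK / √N)) ≤
          m.Lφ * (errorConst B κ D * (1 / √N + σK / √N)) := by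
          gcongr
          exact sqrt_natCast_le_self hN
      _ ≤ m.Lφ / (1 - m.γ) * (errorConst B κ D * max κ 1 *
          ((m.LFgtd2 + m.LK) * (1 / √N) + totalNoise σF σK σy / √N)) :=
        Lφ_mul_le hst hC (by positivity) (sq_nonneg _)
          (div_nonneg (hσK.trans hσ) (Real.sqrt_nonneg _)) (by gcongr)
      _ = _ := by ring
  · intro S _ _ _ _ d m X Y θ₁ w₁ Ω _ μ _ Z σF σK σy hst hZ hnoise N hN
    obtain ⟨θs, hθsX, hθs, hθD⟩ := hst.saddle
    obtain ⟨hi, hle⟩ := integral_gtd2_oracle_error_le hst hZ hθs hθD hnoise.σK_nonneg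
      (hnoise.boundK θs hθsX)
      (fun t => measurable_extraStep hst.X_closed hst.X_convex ⟨θs, hθsX⟩ (tdStepSize B κ t))
      (fun t => isPerturbedStep_extraStep hst.X_closed hst.X_convex hθsX hst.feature_le
        (tdStepSize_pos B κ t).le)
      (x := fun t ω => m.gtd2mp X 0 (tdStepSize B κ) (tdStepSize B κ) θ₁ w₁ (fun i => Z i ω) t)
      (fun ω => rfl) (fun t ω => gtd2mp_succ X _ θ₁ w₁ _ t) hN
    refine ⟨hi, hle.trans ?_⟩
    have hD : 0 ≤ D := (norm_nonneg _).trans hst.y₁_le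
    have hC := errorConst_nonneg B κ hD
    have hσ := le_totalNoise (σF := σF) (σK := σK) hnoise.σy_nonneg
    have hσK := hnoise.σK_nonneg
    calc m.Lφ * (errorConst B κ D * (1 / N + σK / √N)) ≤
          m.Lφ / (1 - m.γ) * (errorConst B κ D * max κ 1 *
          ((m.LFgtd2 + m.LK) * (1 / N) + totalNoise σF σK σy / √N)) :=
        Lφ_mul_le hst hC (by positivity) (sq_nonneg _)
          (div_nonneg (hσK.trans hσ) (Real.sqrt_nonneg _)) (by gcongr)
      _ = _ := by ring
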